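/- Consider the division of $m$ indivisible goods, numbered $1,\dots,m$, among $n\ge 1$ agents, numbered $1,\dots,n$, with additive valuations $v_i$ ($v_i(B)=\sum_{g\in B}v_i(g)$) in a 2-value instance: there are reals $a>b\ge 0$, known to the algorithm, with $v_i(g)\in\{a,b\}$ for every agent $i$ and good $g$. An allocation $(A_i)_{i}$ (disjoint bundles whose union is the set of all goods) is $\mathrm{EFX}_0$ if $v_i(A_i)\ge v_i(A_j\setminus\{g\})$ for all agents $i,j$ and every good $g\in A_j$. The algorithm Match&Freeze maintains the set $R$ of unallocated goods (initially all goods), the set $L$ of active agents (initially all agents) and an ordered list $\ell$ of the agents (initially $1,\dots,n$). As long as $R\neq\varnothing$ it performs a round: (1) Compute a maximum matching in the bipartite graph on $L\cup R$ in which $i\in L$ and $g\in R$ are adjacent iff $v_i(g)=a$; every matched agent receives her matched good, which is removed from $R$. (2) The unmatched active agents, in the order of $\ell$, each receive one arbitrary good that is still in $R$, which is removed from $R$ (as long as $R\ne\varnothing$). (3) For each active agent $i$ that received a good in this round, let $g_i$ be that good. Let $F$ be the smallest set of such agents that contains every $i$ for which there is an agent $j$ with $v_j(g_i)=a$ and $v_j(g_j)=b$,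 and every $i$ for which there is $j\in F$ with $v_j(g_i)=a$. The agents of $F$ are removed from $L$ for the next $\lfloor a/b-1\rfloor$ rounds (forever if $b=0$), and are moved to the end of $\ell$, in any order among themselves. Then, for every 2-value instance with $n\ge1$ agents: (i) whatever maximum matchings, goods and orders are chosen, Match&Freeze never gets stuck, stops after at most $m$ rounds, and outputs an $\mathrm{EFX}_0$ allocation; (ii) Match&Freeze can be carried out in polynomial time: there are one fixed program for a random access machine over the naturals and the reals, whose unit-cost elementary operations are access to constants (natural constants and the real $0$) and memory cells, addition, subtraction, comparison and the logical connectives in tests, and one polynomial $p$ such that, given $n,m,a,b$ and the values $v_i(g)$, the program halts after at most $p(n+m)$ steps and outputs, for some complete execution of Match&Freeze on the instance, the agent who received each good and the round in which she received it. -/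

import Mathlib

/-! Fair division with two-value additive valuations, the round-based algorithm Match&Freeze,
and a machine model with unit-cost elementary operations. Agents are `Fin n`, goods are `Fin m`,
and `v i g` is the value of agent `i` for good `g`. -/

namespace MatchFreeze

/-- A two-value instance using the values `a > b ≥ 0`. -/
structure IsTwoValue {n m : ℕ} (a b : ℝ) (v : Fin n → Fin m → ℝ) : Prop where
  nonneg : 0 ≤ b
  lt : b < a
  mem : ∀ i g, v i g = a ∨ v i g = b

/-- Additive value of agent `i` for a set of goods. -/
def value {n m : ℕ} (v : Fin n → Fin m → ℝ) (i : Fin n) (B : Finset (Fin m)) : ℝ :=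
  ∑ g ∈ B, v i g

/-- A (complete) allocation: disjoint bundles that together contain all goods. -/
def IsAllocation {n m : ℕ} (A : Fin n → Finset (Fin m)) : Prop :=
  (∀ i j, i ≠ j → Disjoint (A i) (A j)) ∧ ∀ g, ∃ i, g ∈ A i

/-- Envy-freeness up to any good (zero-valued goods included). -/
def IsEFX0 {n m : ℕ} (v : Fin n → Fin m → ℝ) (A : Fin n → Finset (Fin m)) : Prop :=
  ∀ i j, ∀ g ∈ A j, value v i (A j \ {g}) ≤ value v i (A i)

/-! ### The algorithm -/

/-- `M` is a matching in the bipartite graph with sides `L` and `R` in which agent `i` and good `g`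
are adjacent iff `v i g = a`. A matching is the set of its edges. -/
def IsMatching {n m : ℕ} (a : ℝ) (v : Fin n → Fin m → ℝ) (L : Finset (Fin n)) (R : Finset (Fin m))
    (M : Finset (Fin n × Fin m)) : Prop :=
  (∀ e ∈ M, e.1 ∈ L ∧ e.2 ∈ R ∧ v e.1 e.2 = a) ∧
    ∀ e ∈ M, ∀ e' ∈ M, (e.1 = e'.1 ∨ e.2 = e'.2) → e = e'

/-- A matching with the largest possible number of edges. -/
def IsMaximumMatching {n m : ℕ} (a : ℝ) (v : Fin n → Fin m → ℝ) (L : Finset (Fin n))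
    (R : Finset (Fin m)) (M : Finset (Fin n × Fin m)) : Prop :=
  IsMatching a v L R M ∧ ∀ M', IsMatching a v L R M' → M'.card ≤ M.card

/-- `Serve l R D`: the agents of the list `l` come one after the other and each receives one
arbitrary good of those that are still left of `R`, until no good is left;
`D` is the set of the pairs (agent, good received). -/
inductive Serve {n m : ℕ} :
    List (Fin n) → Finset (Fin m) → Finset (Fin n × Fin m) → Prop
  | done (R : Finset (Fin m)) : Serve [] R ∅
  | noGoods (l : List (Fin n)) : Serve l ∅ ∅
  | give (i : Fin n) (l : List (Fin n)) (R : Finset (Fin m)) (g : Fin m)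
      (D : Finset (Fin n × Fin m)) (hg : g ∈ R) (hD : Serve l (R.erase g) D) :
      Serve (i :: l) R (insert (i, g) D)

/-- The set `F` of the agents that freeze at the end of a round in which the pairs `E`
(agent, good received) were handed out: the smallest set that contains every agent whose good is
worth `a` to an agent who herself received a good of value `b`, and every agent whose
good is worth `a` to an agent of the set. -/
inductive Freezes {n m : ℕ} (a b : ℝ) (v : Fin n → Fin m → ℝ) (E : Finset (Fin n × Fin m)) :
    Fin n → Prop
  | base (i j : Fin n) (g h : Fin m) (hi : (i, g) ∈ E) (hj : (j, h) ∈ E)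
      (hg : v j g = a) (hh : v j h = b) : Freezes a b v E i
  | step (i j : Fin n) (g : Fin m) (hj : Freezes a b v E j) (hi : (i, g) ∈ E)
      (hg : v j g = a) : Freezes a b v E i

/-- The number `⌊a / b - 1⌋` of rounds for which an agent freezes, infinite if `b = 0`. -/
noncomputable def freezeLength (a b : ℝ) : ℕ∞ :=
  if b = 0 then ⊤ else ((⌊a / b - 1⌋₊ : ℕ) : ℕ∞)

/-- The data that the algorithm maintains between two rounds. -/
structure State (n m : ℕ) where
  /-- the goods that each agent has received so far -/
  bundle : Fin n → Finset (Fin m)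
  /-- the unallocated goods -/
  rest : Finset (Fin m)
  /-- the number of rounds for which each agent still stays frozen -/
  wait : Fin n → ℕ∞
  /-- the ordered list of agents -/
  order : List (Fin n)

/-- At the start nothing is allocated, everyone is active, and the agents are listed in their
natural order. -/
def start (n m : ℕ) : State n m where
  bundle _ := ∅
  rest := Finset.univ
  wait _ := 0
  order := List.finRange n

/-- The active agents. -/
def State.active {n m : ℕ} (s : State n m) : Finset (Fin n) :=
  Finset.univ.filter fun i => s.wait i = 0

open scoped Classical in
/-- `Round a b v s s'`: one round of the algorithm can lead from `s` to `s'`.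
Here `M` is the maximum matching computed in the round and `D` the set of the pairs (agent, good)
handed out afterwards to the unmatched active agents, in the order of the list. The agents that
freeze are moved to the end of the list, in any order among themselves. -/
def Round {n m : ℕ} (a b : ℝ) (v : Fin n → Fin m → ℝ) (s s' : State n m) : Prop :=
  ∃ M D : Finset (Fin n × Fin m),
    IsMaximumMatching a v s.active s.rest M ∧
    Serve (s.order.filter fun i => i ∈ s.active ∧ i ∉ M.image Prod.fst)
      (s.rest \ M.image Prod.snd) D ∧
    (∀ i, s'.bundle i = s.bundle i ∪ Finset.univ.filter fun g => (i, g) ∈ M ∪ D) ∧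
    s'.rest = s.rest \ (M ∪ D).image Prod.snd ∧
    (∀ i, s'.wait i = if Freezes a b v (M ∪ D) i then freezeLength a b else s.wait i - 1) ∧
    ∃ l : List (Fin n), l.Perm (s.order.filter fun i => Freezes a b v (M ∪ D) i) ∧
      s'.order = (s.order.filter fun i => ¬ Freezes a b v (M ∪ D) i) ++ l

/-- The sequence `S 0, …, S K` records the first `K` rounds of an execution of the algorithm.
A round is performed only as long as there are unallocated goods. -/
def IsExecution {n m : ℕ} (a b : ℝ) (v : Fin n → Fin m → ℝ) (S : ℕ → State n m) (K : ℕ) : Prop :=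
  S 0 = start n m ∧ ∀ t < K, (S t).rest ≠ ∅ ∧ Round a b v (S t) (S (t + 1))

/-! ### The machine model

A random access machine over the naturals and the reals, programmed in a structured language. The
memory has natural number cells and real cells, both with two-index addresses. The only
arithmetic is addition and subtraction, the only tests are comparisons; there are no
multiplication, division and rounding, and reals cannot be turned into naturals except
by comparisons. Every operation costs one step. -/

/-- Contents of the memory. -/
structure Memory where
  /-- the natural number cells -/
  nat : ℕ → ℕ → ℕ
  /-- the real cells -/
  real : ℕ → ℕ → ℝ

/-- Expressions with natural number values. -/
inductive NatExp where
  | const (c : ℕ)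
  | cell (x y : NatExp)
  | add (e f : NatExp)
  | sub (e f : NatExp)

/-- Value of an expression (subtraction is truncated). -/
def NatExp.eval (σ : Memory) : NatExp → ℕ
  | .const c => c
  | .cell x y => σ.nat (x.eval σ) (y.eval σ)
  | .add e f => e.eval σ + f.eval σ
  | .sub e f => e.eval σ - f.eval σ

/-- Number of operations in an expression. -/
def NatExp.cost : NatExp → ℕ
  | .const _ => 1
  | .cell x y => x.cost + y.cost + 1
  | .add e f => e.cost + f.cost + 1
  | .sub e f => e.cost + f.cost + 1

/-- Expressions with real values. -/
inductive RealExp where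
  | zero
  | cell (x y : NatExp)
  | add (e f : RealExp)
  | sub (e f : RealExp)

/-- Value of an expression. -/
noncomputable def RealExp.eval (σ : Memory) : RealExp → ℝ
  | .zero => 0
  | .cell x y => σ.real (x.eval σ) (y.eval σ)
  | .add e f => e.eval σ + f.eval σ
  | .sub e f => e.eval σ - f.eval σ

/-- Number of operations in an expression. -/
def RealExp.cost : RealExp → ℕ
  | .zero => 1
  | .cell x y => x.cost + y.cost + 1
  | .add e f => e.cost + f.cost + 1
  | .sub e f => e.cost + f.cost + 1

/-- Tests. -/
inductive Test where
  | natLt (e f : NatExp)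
  | realLt (e f : RealExp)
  | not (c : Test)
  | and (c d : Test)

/-- The test succeeds. -/
def Test.Holds (σ : Memory) : Test → Prop
  | .natLt e f => e.eval σ < f.eval σ
  | .realLt e f => e.eval σ < f.eval σ
  | .not c => ¬ c.Holds σ
  | .and c d => c.Holds σ ∧ d.Holds σ

/-- Number of operations in a test. -/
def Test.cost : Test → ℕ
  | .natLt e f => e.cost + f.cost + 1
  | .realLt e f => e.cost + f.cost + 1
  | .not c => c.cost + 1
  | .and c d => c.cost + d.cost + 1

/-- Programs. -/
inductive Program where
  | skip
  | setNat (x y e : NatExp)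
  | setReal (x y : NatExp) (e : RealExp)
  | seq (c d : Program)
  | ite (t : Test) (c d : Program)
  | loop (t : Test) (c : Program)

/-- Overwrite one natural number cell. -/
def Memory.setNat (σ : Memory) (x y k : ℕ) : Memory where
  nat := fun x' y' => if x' = x ∧ y' = y then k else σ.nat x' y'
  real := σ.real

/-- Overwrite one real cell. -/
noncomputable def Memory.setReal (σ : Memory) (x y : ℕ) (r : ℝ) : Memory where
  nat := σ.nat
  real := fun x' y' => if x' = x ∧ y' = y then r else σ.real x' y'

/-- `Exec c σ k τ`: the program `c`, started on the memory `σ`, halts with the memory `τ` after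
`k` steps. `loop t c` repeats `c` while `t` holds. -/
inductive Exec : Program → Memory → ℕ → Memory → Prop
  | skip (σ : Memory) : Exec .skip σ 1 σ
  | setNat (x y e : NatExp) (σ : Memory) :
      Exec (.setNat x y e) σ (x.cost + y.cost + e.cost + 1)
        (σ.setNat (x.eval σ) (y.eval σ) (e.eval σ))
  | setReal (x y : NatExp) (e : RealExp) (σ : Memory) :
      Exec (.setReal x y e) σ (x.cost + y.cost + e.cost + 1)
        (σ.setReal (x.eval σ) (y.eval σ) (e.eval σ))
  | seq (c d : Program) (σ ρ τ : Memory) (k l : ℕ) (hc : Exec c σ k ρ) (hd : Exec d ρ l τ) :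
      Exec (.seq c d) σ (k + l) τ
  | iteTrue (t : Test) (c d : Program) (σ τ : Memory) (k : ℕ) (ht : t.Holds σ)
      (hc : Exec c σ k τ) : Exec (.ite t c d) σ (t.cost + k + 1) τ
  | iteFalse (t : Test) (c d : Program) (σ τ : Memory) (k : ℕ) (ht : ¬ t.Holds σ)
      (hd : Exec d σ k τ) : Exec (.ite t c d) σ (t.cost + k + 1) τ
  | loopTrue (t : Test) (c : Program) (σ ρ τ : Memory) (k l : ℕ) (ht : t.Holds σ)
      (hc : Exec c σ k ρ) (hl : Exec (.loop t c) ρ l τ) :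
      Exec (.loop t c) σ (t.cost + k + l + 1) τ
  | loopFalse (t : Test) (c : Program) (σ : Memory) (ht : ¬ t.Holds σ) :
      Exec (.loop t c) σ (t.cost + 1) σ

/-- The memory that holds the input: `n` and `m` in the natural number cells `(0, 0)` and `(1, 0)`,
`a` and `b` in the real cells `(0, 0)` and `(0, 1)`, and `v i g` in the real cell `(i + 1, g)`.
All other cells are zero. -/
def inputMemory {n m : ℕ} (a b : ℝ) (v : Fin n → Fin m → ℝ) : Memory where
  nat
    | 0, 0 => n
    | 1, 0 => m
    | _, _ => 0
  real
    | 0, 0 => a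
    | 0, 1 => b
    | 0, _ => 0
    | i + 1, g => if h : i < n ∧ g < m then v ⟨i, h.1⟩ ⟨g, h.2⟩ else 0

/-- The memory `τ` holds the allocation produced by the first `K` rounds `S`, together with the
rounds (numbered from 1) in which the goods were handed out: for every good `g`, the cell `(2, g)`
contains the agent who received `g`, and the cell `(3, g)` the round in which she received it. -/
def HoldsOutput {n m : ℕ} (S : ℕ → State n m) (K : ℕ) (τ : Memory) : Prop :=
  ∀ g : Fin m, ∃ i : Fin n, ∃ t < K, τ.nat 2 g = i ∧ τ.nat 3 g = t + 1 ∧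
    g ∉ (S t).bundle i ∧ g ∈ (S (t + 1)).bundle i

end MatchFreeze

/-! Fairness. Fix agents `i` and `j`. As long as `i` receives a good worth `a` in every round,
counting suffices: after `t` rounds she has value `t * a`, while `j` has at most `t` goods. To see
what happens afterwards, take a vertex cover of the graph of a round, agents `C` and goods `P`, that
is as large as the maximum matching. An agent outside `C` values at `a` only goods of `P`, and these
are all matched in this round. Agents who receive a good worth `b` lie outside `C`, and so do all
agents who freeze. From then on the remaining goods are worth `b` to all of them (`Round.facts`).

After the early stage, therefore, every further good changes a value of `i` by exactly `b`. The
freeze length `k` satisfies `(k + 1) * b ≤ a < (k + 2) * b` for `b > 0`. The first inequality says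
that an agent who freezes with a lead of `a - b` does not fall behind while frozen. The second says
that the lead of an agent who froze with a good envied by `i` has shrunk to at most `b` when she
returns. She is then behind `i` in the list, so she receives no good that `i` misses. `Stage`
records these four situations, `RoundFacts.stage` shows that a round leads from one to another (or
ends the algorithm without envy), and `Stage.noEnvy` reads off the fairness condition. Somebody is
always active, because a freeze is ultimately caused by an agent with a low good, who stays active;
hence each round hands out a good and there are at most `m` rounds.

Complexity. Maximum matchings are found by an auction in which waiting agents take the cheapest
adjacent good and raise its price by one, with cap `m + 1`. An unused price level between 1 and the
cap separates a cover of the same size as the matching (`Auction.exists_cover`); this proves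
optimality and König's theorem, which the fairness part needs. The program is verified in a weakest
precondition calculus where each loop runs at most `B` times, so that the number of steps is a fixed
polynomial in `B` (`Program.WP.exec`). Freeze lengths are computed by repeated addition, only up to
`m`, which is harmless since there are at most `m` rounds. The list of agents is not stored: it is
sorted by the round of the most recent freeze, with ties in natural order (`sortedList`).
`Simulates` ties the memory to an execution, and `Program.wp_round` carries it through a round. -/

namespace MatchFreeze

/-! ### Auctions for bipartite matchings -/

/-- The state of an auction for a maximum matching in the bipartite graph `adj`: good `g` is held
by the agent `own g - 1` (by nobody if `own g = 0`) at the price `price g`, and the agent `i` is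
waiting (`st i = 0`), holds a good (`st i = 1`) or has given up (`st i = 2`). -/
structure Auction (n m : ℕ) (adj : ℕ → ℕ → Prop) (own price st : ℕ → ℕ) : Prop where
  lt : ∀ i g, adj i g → i < n ∧ g < m
  adj_of_own : ∀ i g, g < m → own g = i + 1 → adj i g
  st_of_own : ∀ i g, g < m → own g = i + 1 → st i = 1
  inj : ∀ i g h, g < m → h < m → own g = i + 1 → own h = i + 1 → g = h
  own_of_st : ∀ i < n, st i = 1 → ∃ g < m, own g = i + 1
  own_ne_zero : ∀ g < m, 0 < price g → own g ≠ 0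
  price_le : ∀ g < m, price g ≤ m + 1
  tight : ∀ i g h, g < m → own g = i + 1 → adj i h → price g ≤ price h + 1
  gave_up : ∀ i h, st i = 2 → adj i h → m + 1 ≤ price h
  st_le : ∀ i < n, st i ≤ 2

namespace Auction

variable {n m : ℕ} {adj : ℕ → ℕ → Prop} {own price st : ℕ → ℕ}

/-- An upper bound for the number of steps until nobody waits. -/
def potential (n m : ℕ) (price st : ℕ → ℕ) : ℕ :=
  (∑ g ∈ Finset.range m, (m + 1 - price g)) + ((Finset.range n).filter fun i => st i ≠ 2).card

theorem potential_le (n m : ℕ) (price st : ℕ → ℕ) : potential n m price st ≤ m * (m + 1) + n := by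
  unfold potential
  refine Nat.add_le_add ?_ ?_
  · calc _ ≤ ∑ g ∈ Finset.range m, (m + 1) := Finset.sum_le_sum fun _ _ => Nat.sub_le _ _
      _ = _ := by simp
  · exact (Finset.card_filter_le _ _).trans (by simp)

theorem initial (hlt : ∀ i g, adj i g → i < n ∧ g < m)
    (hown : ∀ g < m, own g = 0) (hprice : ∀ g < m, price g = 0)
    (hst : ∀ i < n, st i = 0 ∨ st i = 2) (hadj : ∀ i g, adj i g → st i = 0) :
    Auction n m adj own price st where
  lt := hlt
  adj_of_own i g hg h := by simp [hown g hg] at h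
  st_of_own i g hg h := by simp [hown g hg] at h
  inj i g h hg _ h1 := by simp [hown g hg] at h1
  own_of_st i hi h := by have := hst i hi; omega
  own_ne_zero g hg h := by simp [hprice g hg] at h
  price_le g hg := by simp [hprice g hg]
  tight i g h hg h1 := by simp [hown g hg] at h1
  gave_up i h h1 h2 := by have := hadj i h h2; omega
  st_le i hi := by have := hst i hi; omega

/-- Prices never fall, so an agent without an adjacent good below the cap can leave for good; this
lowers the second summand of the potential. -/
theorem give_up (H : Auction n m adj own price st) {i : ℕ} (hi : i < n) (h0 : st i = 0)
    (hall : ∀ h, adj i h → m + 1 ≤ price h) :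
    Auction n m adj own price (Function.update st i 2) ∧
      potential n m price (Function.update st i 2) < potential n m price st := by
  refine ⟨⟨H.lt, H.adj_of_own, ?_, H.inj, ?_, H.own_ne_zero, H.price_le, H.tight, ?_, ?_⟩, ?_⟩
  · intro j g hg h
    have := H.st_of_own j g hg h
    rw [Function.update_of_ne]
    · exact this
    · rintro rfl; omega
  · intro j hj h
    by_cases hji : j = i
    · subst hji; simp at h
    · rw [Function.update_of_ne hji] at h
      exact H.own_of_st j hj h
  · intro j h hj hadj
    by_cases hji : j = i
    · subst hji; exact hall h hadj
    · rw [Function.update_of_ne hji] at hj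
      exact H.gave_up j h hj hadj
  · intro j hj
    by_cases hji : j = i
    · subst hji; simp
    · rw [Function.update_of_ne hji]; exact H.st_le j hj
  · unfold potential
    refine Nat.add_lt_add_left (Finset.card_lt_card ?_) _
    rw [Finset.ssubset_iff_of_subset]
    · exact ⟨i, by simp [hi, h0], by simp⟩
    · intro j
      by_cases hji : j = i
      · subst hji; simp
      · simp [Function.update_of_ne hji]

/-- The statuses after the owner of `h` (if any) has been dispossessed. -/
def dispossess (own st : ℕ → ℕ) (h : ℕ) : ℕ → ℕ :=
  if 0 < own h then Function.update st (own h - 1) 0 else st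

/-- Tightness holds for the buyer because the good was her cheapest, and survives for the others
because no price falls. The dispossessed owner waits again but has not given up, so the second
summand of the potential is unchanged, while the raised price, still at most the cap, lowers the
first. -/
theorem take (H : Auction n m adj own price st) {i h : ℕ} (h0 : st i = 0)
    (hadj : adj i h) (hcap : price h < m + 1) (hmin : ∀ g, adj i g → price h ≤ price g) :
    Auction n m adj (Function.update own h (i + 1)) (Function.update price h (price h + 1))
        (Function.update (dispossess own st h) i 1) ∧
      potential n m (Function.update price h (price h + 1))
        (Function.update (dispossess own st h) i 1) < potential n m price st := by
  obtain ⟨hi, hh⟩ := H.lt i h hadj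
  set st' := Function.update (dispossess own st h) i 1 with hst'
  have hsti : st' i = 1 := by simp [hst']
  have hst2 : ∀ j, st' j = 2 ↔ st j = 2 := by
    intro j
    by_cases hji : j = i
    · subst hji; simp [hsti, h0]
    · rw [hst', Function.update_of_ne hji]
      unfold dispossess
      split_ifs with hp
      · by_cases hj : j = own h - 1
        · have := H.st_of_own j h hh (by omega)
          rw [this, hj]; simp
        · rw [Function.update_of_ne hj]
      · rfl
  have hst1 : ∀ j, j ≠ i → own h ≠ j + 1 → st' j = st j := by
    intro j hji hj
    rw [hst', Function.update_of_ne hji]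
    unfold dispossess
    split_ifs with hp
    · rw [Function.update_of_ne (by omega)]
    · rfl
  have hkick : ∀ j, j ≠ i → own h = j + 1 → st' j = 0 := by
    intro j hji hj
    rw [hst', Function.update_of_ne hji]
    unfold dispossess
    rw [if_pos (by omega), hj]
    simp
  have hpr : ∀ g, price g ≤ Function.update price h (price h + 1) g := by
    intro g
    by_cases hg : g = h
    · subst hg; simp
    · rw [Function.update_of_ne hg]
  refine ⟨⟨H.lt, ?_, ?_, ?_, ?_, ?_, ?_, ?_, ?_, ?_⟩, ?_⟩
  · intro j g hg hj
    by_cases hgh : g = h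
    · subst hgh
      simp at hj; subst hj; exact hadj
    · rw [Function.update_of_ne hgh] at hj
      exact H.adj_of_own j g hg hj
  · intro j g hg hj
    by_cases hgh : g = h
    · subst hgh
      simp at hj; subst hj; exact hsti
    · rw [Function.update_of_ne hgh] at hj
      have h1 := H.st_of_own j g hg hj
      rw [hst1 j (by rintro rfl; omega) (fun hc => hgh (H.inj j g h hg hh hj hc))]
      exact h1
  · intro j g g' hg hg' hj hj'
    have key : ∀ f, f < m → f ≠ h → Function.update own h (i + 1) f = i + 1 → False := by
      intro f hf hfh hc
      rw [Function.update_of_ne hfh] at hc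
      have := H.st_of_own i f hf hc
      omega
    by_cases hgh : g = h
    · by_cases hgh' : g' = h
      · rw [hgh, hgh']
      · subst hgh
        simp at hj; subst hj
        exact (key g' hg' hgh' hj').elim
    · by_cases hgh' : g' = h
      · subst hgh'
        simp at hj'; subst hj'
        exact (key g hg hgh hj).elim
      · rw [Function.update_of_ne hgh] at hj
        rw [Function.update_of_ne hgh'] at hj'
        exact H.inj j g g' hg hg' hj hj'
  · intro j hj h1
    by_cases hji : j = i
    · subst hji
      exact ⟨h, hh, by simp⟩
    · by_cases hk : own h = j + 1
      · rw [hkick j hji hk] at h1; omega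
      · rw [hst1 j hji hk] at h1
        obtain ⟨g, hg, hg'⟩ := H.own_of_st j hj h1
        refine ⟨g, hg, ?_⟩
        rw [Function.update_of_ne]
        · exact hg'
        · rintro rfl; exact hk hg'
  · intro g hg hp
    by_cases hgh : g = h
    · subst hgh; simp
    · rw [Function.update_of_ne hgh] at hp ⊢
      exact H.own_ne_zero g hg hp
  · intro g hg
    by_cases hgh : g = h
    · subst hgh; simpa using hcap
    · rw [Function.update_of_ne hgh]; exact H.price_le g hg
  · intro j g g' hg hj hadj'
    by_cases hgh : g = h
    · subst hgh
      simp only [Function.update_self, Nat.add_right_cancel_iff] at hj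
      subst hj
      have := hmin g' hadj'
      have := hpr g'
      simp only [Function.update_self]
      omega
    · rw [Function.update_of_ne hgh] at hj ⊢
      have := H.tight j g g' hg hj hadj'
      have := hpr g'
      omega
  · intro j g hj hadj'
    have := H.gave_up j g ((hst2 j).1 hj) hadj'
    have := hpr g
    omega
  · intro j hj
    by_cases hji : j = i
    · subst hji; omega
    · by_cases hk : own h = j + 1
      · rw [hkick j hji hk]; omega
      · rw [hst1 j hji hk]; exact H.st_le j hj
  · unfold potential
    have h2 : ((Finset.range n).filter fun j => st' j ≠ 2)
        = (Finset.range n).filter fun j => st j ≠ 2 := by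
      ext j; simp [hst2]
    rw [h2]
    refine Nat.add_lt_add_right (Finset.sum_lt_sum ?_ ⟨h, by simpa using hh, ?_⟩) _
    · intro g _
      have := hpr g
      omega
    · simp only [Function.update_self]
      omega

/-- Starting from any state, an auction can be continued until nobody waits. -/
theorem exists_end (H : Auction n m adj own price st) :
    ∃ own' price' st', Auction n m adj own' price' st' ∧ ∀ i < n, st' i ≠ 0 := by
  induction hk : potential n m price st using Nat.strong_induction_on generalizing own price st with
  | _ k ih =>
  by_cases hw : ∀ i < n, st i ≠ 0
  · exact ⟨_, _, _, H, hw⟩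
  push Not at hw
  obtain ⟨i, hi, h0⟩ := hw
  by_cases hall : ∀ h, adj i h → m + 1 ≤ price h
  · obtain ⟨H', hlt⟩ := H.give_up hi h0 hall
    exact ih _ (hk ▸ hlt) H' rfl
  · push Not at hall
    classical
    obtain ⟨h', ha', hc'⟩ := hall
    obtain ⟨h, hh, hmin⟩ := ((Finset.range m).filter (adj i)).exists_min_image price
      ⟨h', by simp [(H.lt i h' ha').2, ha']⟩
    simp only [Finset.mem_filter, Finset.mem_range] at hh hmin
    obtain ⟨H', hlt⟩ := H.take h0 hh.2 ((hmin h' ⟨(H.lt i h' ha').2, ha'⟩).trans_lt hc')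
      fun g hg => hmin g ⟨(H.lt i g hg).2, hg⟩
    exact ih _ (hk ▸ hlt) H' rfl

end Auction

/-! ### Vertex covers and König's theorem -/

section Matching

variable {n m : ℕ} {a : ℝ} {v : Fin n → Fin m → ℝ} {L : Finset (Fin n)} {R : Finset (Fin m)}
  {M : Finset (Fin n × Fin m)}

/-- Every edge of the graph on `L` and `R` has an end in `C` or in `P`. -/
def IsCover (a : ℝ) (v : Fin n → Fin m → ℝ) (L : Finset (Fin n)) (R : Finset (Fin m))
    (C : Finset (Fin n)) (P : Finset (Fin m)) : Prop :=
  ∀ i ∈ L, ∀ g ∈ R, v i g = a → i ∈ C ∨ g ∈ P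

theorem IsMatching.injOn_fst (h : IsMatching a v L R M) :
    Set.InjOn Prod.fst (M : Set (Fin n × Fin m)) :=
  fun _ he _ he' hee => h.2 _ he _ he' (Or.inl hee)

theorem IsMatching.injOn_snd (h : IsMatching a v L R M) :
    Set.InjOn Prod.snd (M : Set (Fin n × Fin m)) :=
  fun _ he _ he' hee => h.2 _ he _ he' (Or.inr hee)

theorem IsMatching.card_filter_fst_le (h : IsMatching a v L R M) (C : Finset (Fin n)) :
    (M.filter fun e => e.1 ∈ C).card ≤ C.card :=
  Finset.card_le_card_of_injOn Prod.fst (fun e he => by simp at he; exact he.2)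
    (h.injOn_fst.mono (Finset.coe_subset.2 (Finset.filter_subset _ _)))

theorem IsMatching.card_filter_snd_le (h : IsMatching a v L R M) (P : Finset (Fin m)) :
    (M.filter fun e => e.2 ∈ P).card ≤ P.card :=
  Finset.card_le_card_of_injOn Prod.snd (fun e he => by simp at he; exact he.2)
    (h.injOn_snd.mono (Finset.coe_subset.2 (Finset.filter_subset _ _)))

theorem IsCover.union_filter {C : Finset (Fin n)} {P : Finset (Fin m)} (hc : IsCover a v L R C P)
    (h : IsMatching a v L R M) :
    (M.filter fun e => e.1 ∈ C) ∪ (M.filter fun e => e.2 ∈ P) = M := by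
  rw [← Finset.filter_or]
  refine Finset.filter_true_of_mem fun e he => ?_
  obtain ⟨h1, h2, h3⟩ := h.1 e he
  exact hc _ h1 _ h2 h3

/-- Weak duality: each edge of a matching has an end in the cover, and each vertex of the cover
meets at most one edge. -/
theorem IsCover.card_le {C : Finset (Fin n)} {P : Finset (Fin m)} (hc : IsCover a v L R C P)
    (h : IsMatching a v L R M) : M.card ≤ C.card + P.card := by
  rw [← hc.union_filter h]
  exact (Finset.card_union_le _ _).trans
    (Nat.add_le_add (h.card_filter_fst_le C) (h.card_filter_snd_le P))

/-- A matching as large as a cover is maximum, and the cover is tight. -/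
theorem IsCover.tight {C : Finset (Fin n)} {P : Finset (Fin m)} (hc : IsCover a v L R C P)
    (h : IsMatching a v L R M) (hcard : C.card + P.card ≤ M.card) :
    (∀ i ∈ C, ∃ g, (i, g) ∈ M) ∧ (∀ g ∈ P, ∃ i, (i, g) ∈ M) ∧
      ∀ i g, (i, g) ∈ M → g ∈ P → i ∉ C := by
  have h1 := h.card_filter_fst_le C
  have h2 := h.card_filter_snd_le P
  -- Edges with both ends in the cover are counted twice by `C.card + P.card`; equality of sizes
  -- leaves no room for them, nor for unmatched vertices of the cover.
  have h3 := Finset.card_union_add_card_inter (M.filter fun e => e.1 ∈ C)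
    (M.filter fun e => e.2 ∈ P)
  rw [hc.union_filter h] at h3
  refine ⟨fun i hi => ?_, fun g hg => ?_, fun i g hM hP hC => ?_⟩
  · have := Finset.eq_of_subset_of_card_le (s := (M.filter fun e => e.1 ∈ C).image Prod.fst)
      (t := C) (by intro x; simp only [Finset.mem_image, Finset.mem_filter]; grind)
      (by rw [Finset.card_image_of_injOn (h.injOn_fst.mono (Finset.coe_subset.2 (Finset.filter_subset _ _)))]; omega)
    rw [← this] at hi
    simp only [Finset.mem_image, Finset.mem_filter] at hi
    grind
  · have := Finset.eq_of_subset_of_card_le (s := (M.filter fun e => e.2 ∈ P).image Prod.snd)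
      (t := P) (by intro x; simp only [Finset.mem_image, Finset.mem_filter]; grind)
      (by rw [Finset.card_image_of_injOn (h.injOn_snd.mono (Finset.coe_subset.2 (Finset.filter_subset _ _)))]; omega)
    rw [← this] at hg
    simp only [Finset.mem_image, Finset.mem_filter] at hg
    grind
  · have : (i, g) ∈ (M.filter fun e => e.1 ∈ C) ∩ (M.filter fun e => e.2 ∈ P) := by
      simp [hM, hP, hC]
    have := Finset.card_pos.2 ⟨_, this⟩
    omega

/-- Adjacency in the graph on `L` and `R`, in terms of natural numbers. -/
def natAdj (a : ℝ) (v : Fin n → Fin m → ℝ) (L : Finset (Fin n)) (R : Finset (Fin m))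
    (i g : ℕ) : Prop :=
  ∃ (hi : i < n) (hg : g < m), ⟨i, hi⟩ ∈ L ∧ ⟨g, hg⟩ ∈ R ∧ v ⟨i, hi⟩ ⟨g, hg⟩ = a

theorem natAdj_coe {i : Fin n} {g : Fin m} :
    natAdj a v L R i g ↔ i ∈ L ∧ g ∈ R ∧ v i g = a := by
  simp [natAdj]

/-- The pairs of an agent and the good that she holds. -/
def heldPairs (n m : ℕ) (own : ℕ → ℕ) : Finset (Fin n × Fin m) :=
  Finset.univ.filter fun e => own e.2 = e.1 + 1

theorem mem_heldPairs {own : ℕ → ℕ} {i : Fin n} {g : Fin m} :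
    (i, g) ∈ heldPairs n m own ↔ own g = i + 1 := by
  simp [heldPairs]

/-- When nobody waits any more, the auction has found a maximum matching and a cover of the same
size. -/
theorem Auction.exists_cover {own price st : ℕ → ℕ}
    (H : Auction n m (natAdj a v L R) own price st) (hend : ∀ i < n, st i ≠ 0) :
    IsMatching a v L R (heldPairs n m own) ∧
      ∃ C P, IsCover a v L R C P ∧ C.card + P.card ≤ (heldPairs n m own).card := by
  have hM : IsMatching a v L R (heldPairs n m own) := by
    refine ⟨?_, ?_⟩
    · rintro ⟨i, g⟩ he
      rw [mem_heldPairs] at he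
      exact natAdj_coe.1 (H.adj_of_own _ _ g.2 he)
    · rintro ⟨i, g⟩ he ⟨j, h⟩ he' hee
      rw [mem_heldPairs] at he he'
      rcases hee with hee | hee
      · simp only at hee
        subst hee
        have := Fin.ext (H.inj i g h g.2 h.2 he he')
        rw [this]
      · simp only at hee
        subst hee
        rw [he] at he'
        have : i = j := Fin.ext (by omega)
        rw [this]
  refine ⟨hM, ?_⟩
  -- Pigeonhole: `m` goods cannot use all `m + 1` price levels. This is the reason for the cap.
  obtain ⟨c, hc, hcg⟩ : ∃ c ∈ Finset.Icc 1 (m + 1), c ∉ (Finset.range m).image price := by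
    by_contra! hcon
    have := Finset.card_le_card (show Finset.Icc 1 (m + 1) ⊆ (Finset.range m).image price from hcon)
    have h2 := Finset.card_image_le (s := Finset.range m) (f := price)
    simp at this h2
    omega
  simp only [Finset.mem_Icc] at hc
  simp only [Finset.mem_image, Finset.mem_range, not_exists, not_and] at hcg
  -- The cover consists of the agents who hold a good below the gap and the goods above it. An agent
  -- holding a good above the gap sees, by tightness, only prices at least `c`, hence above `c`; one
  -- who gave up sees only prices at the cap.
  refine ⟨((heldPairs n m own).filter fun e => price e.2 < c).image Prod.fst,
    Finset.univ.filter fun g => c < price g, ?_, ?_⟩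
  · intro i hi g hg hv
    have hadj : natAdj a v L R i g := natAdj_coe.2 ⟨hi, hg, hv⟩
    have h1 := H.st_le i i.2
    have h2 := hend i i.2
    have h3 := hcg g g.2
    by_cases hst : st i = 2
    · right
      have := H.gave_up i g hst hadj
      simp; omega
    · obtain ⟨g0, hg0, ho⟩ := H.own_of_st i i.2 (by omega)
      by_cases hp : price g0 < c
      · left
        simp only [Finset.mem_image, Finset.mem_filter]
        exact ⟨(i, ⟨g0, hg0⟩), ⟨by simpa [heldPairs] using ho, hp⟩, rfl⟩
      · right
        have := H.tight i g0 g hg0 ho hadj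
        have := hcg g0 hg0
        simp; omega
  -- Goods above the gap have a positive price and are therefore held. The two parts of the cover
  -- are thus charged to complementary sets of held pairs.
  · have h1 : (Finset.univ.filter fun g : Fin m => c < price g)
        ⊆ ((heldPairs n m own).filter fun e => ¬ price e.2 < c).image Prod.snd := by
      intro g hg
      simp only [Finset.mem_filter, Finset.mem_univ, true_and] at hg
      have := H.own_ne_zero g g.2 (by omega)
      obtain ⟨i, hi⟩ := Nat.exists_eq_succ_of_ne_zero this
      have hin := (H.lt i g (H.adj_of_own i g g.2 hi)).1
      simp only [Finset.mem_image, Finset.mem_filter]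
      exact ⟨(⟨i, hin⟩, g), ⟨by simpa [heldPairs] using hi, by simp; omega⟩, rfl⟩
    calc _ ≤ ((heldPairs n m own).filter fun e => price e.2 < c).card
            + ((heldPairs n m own).filter fun e => ¬ price e.2 < c).card :=
          Nat.add_le_add Finset.card_image_le
            ((Finset.card_le_card h1).trans Finset.card_image_le)
      _ = _ := Finset.card_filter_add_card_filter_not _

theorem Auction.isMaximumMatching {own price st : ℕ → ℕ}
    (H : Auction n m (natAdj a v L R) own price st) (hend : ∀ i < n, st i ≠ 0) :
    IsMaximumMatching a v L R (heldPairs n m own) := by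
  obtain ⟨hM, C, P, hc, hcard⟩ := H.exists_cover hend
  exact ⟨hM, fun M' hM' => (hc.card_le hM').trans hcard⟩

/-- König's theorem. -/
theorem exists_matching_cover (a : ℝ) (v : Fin n → Fin m → ℝ) (L : Finset (Fin n))
    (R : Finset (Fin m)) :
    ∃ M, IsMatching a v L R M ∧ ∃ C P, IsCover a v L R C P ∧ C.card + P.card ≤ M.card := by
  have H : Auction n m (natAdj a v L R) (fun _ => 0) (fun _ => 0) (fun _ => 0) :=
    Auction.initial (fun i g h => ⟨h.1, h.2.1⟩) (by simp) (by simp) (by simp) (by simp)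
  obtain ⟨own, price, st, H', hend⟩ := H.exists_end
  exact ⟨_, H'.exists_cover hend⟩

theorem exists_isMaximumMatching (a : ℝ) (v : Fin n → Fin m → ℝ) (L : Finset (Fin n))
    (R : Finset (Fin m)) : ∃ M, IsMaximumMatching a v L R M := by
  obtain ⟨M, hM, C, P, hc, hcard⟩ := exists_matching_cover a v L R
  exact ⟨M, hM, fun M' hM' => (hc.card_le hM').trans hcard⟩

/-- A maximum matching has a tight cover. -/
theorem IsMaximumMatching.exists_cover (h : IsMaximumMatching a v L R M) :
    ∃ C P, IsCover a v L R C P ∧ (∀ i ∈ C, ∃ g, (i, g) ∈ M) ∧ (∀ g ∈ P, ∃ i, (i, g) ∈ M) ∧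
      ∀ i g, (i, g) ∈ M → g ∈ P → i ∉ C := by
  obtain ⟨M', hM', C, P, hc, hcard⟩ := exists_matching_cover a v L R
  exact ⟨C, P, hc, hc.tight h.1 (hcard.trans (h.2 M' hM'))⟩

end Matching

end MatchFreeze

/-! ### The structure of a single round -/

namespace MatchFreeze

variable {n m : ℕ} {a b : ℝ} {v : Fin n → Fin m → ℝ}

section Serve

variable {l : List (Fin n)} {R : Finset (Fin m)} {D : Finset (Fin n × Fin m)}

theorem Serve.mem (h : Serve l R D) : ∀ i g, (i, g) ∈ D → i ∈ l ∧ g ∈ R := by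
  induction h with
  | done R => simp
  | noGoods l => simp
  | give i l R g D hg hD ih =>
    intro j k hjk
    simp only [Finset.mem_insert, Prod.mk.injEq] at hjk
    rcases hjk with ⟨rfl, rfl⟩ | hjk
    · simp [hg]
    · obtain ⟨h1, h2⟩ := ih j k hjk
      exact ⟨List.mem_cons_of_mem _ h1, Finset.mem_of_mem_erase h2⟩

theorem Serve.inj (h : Serve l R D) : ∀ i j g, (i, g) ∈ D → (j, g) ∈ D → i = j := by
  induction h with
  | done R => simp
  | noGoods l => simp
  | give i l R g D hg hD ih =>
    intro j k h hj hk
    simp only [Finset.mem_insert, Prod.mk.injEq] at hj hk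
    have := fun j h => hD.mem j h
    grind

theorem Serve.functional (h : Serve l R D) (hl : l.Nodup) :
    ∀ i g h, (i, g) ∈ D → (i, h) ∈ D → g = h := by
  induction h with
  | done R => simp
  | noGoods l => simp
  | give i l R g D hg hD ih =>
    intro j k h hj hk
    simp only [Finset.mem_insert, Prod.mk.injEq] at hj hk
    have := fun j h => hD.mem j h
    rw [List.nodup_cons] at hl
    grind

/-- When somebody receives nothing, all goods are handed out. -/
theorem Serve.full (h : Serve l R D) :
    ∀ i ∈ l, (∀ g, (i, g) ∉ D) → ∀ g ∈ R, ∃ j, (j, g) ∈ D := by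
  induction h with
  | done R => simp
  | noGoods l => simp
  | give i l R g D hg hD ih =>
    intro j hj hno k hk
    have hji : j ≠ i := by
      rintro rfl
      exact hno g (Finset.mem_insert_self _ _)
    by_cases hkg : k = g
    · exact ⟨i, by simp [hkg]⟩
    · obtain ⟨q, hq⟩ := ih j (by simpa [hji] using hj)
        (fun h hh => hno h (Finset.mem_insert_of_mem hh)) k (by simp [hk, hkg])
      exact ⟨q, Finset.mem_insert_of_mem hq⟩

/-- The agents are served in the order of the list. -/
theorem Serve.of_before (h : Serve l R D) (hl : l.Nodup) :
    ∀ i j g, [i, j].Sublist l → (j, g) ∈ D → ∃ h, (i, h) ∈ D := by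
  induction h with
  | done R => simp
  | noGoods l => simp
  | give i l R g D hg hD ih =>
    intro p q h hpq hq
    by_cases hpi : p = i
    · exact ⟨g, by simp [hpi]⟩
    · have hsub : [p, q].Sublist l := by
        cases hpq with
        | cons _ h => exact h
        | cons_cons _ h => exact (hpi rfl).elim
      rw [List.nodup_cons] at hl
      have hqi : q ≠ i := by
        rintro rfl
        exact hl.1 (hsub.subset (by simp))
      simp only [Finset.mem_insert, Prod.mk.injEq, hqi, false_and, false_or] at hq
      obtain ⟨k, hk⟩ := ih hl.2 p q h hsub hq
      exact ⟨k, Finset.mem_insert_of_mem hk⟩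

theorem exists_serve (l : List (Fin n)) (R : Finset (Fin m)) : ∃ D, Serve l R D := by
  induction l generalizing R with
  | nil => exact ⟨_, .done R⟩
  | cons i l ih =>
    rcases R.eq_empty_or_nonempty with rfl | ⟨g, hg⟩
    · exact ⟨_, .noGoods _⟩
    · obtain ⟨D, hD⟩ := ih (R.erase g)
      exact ⟨_, .give i l R g D hg hD⟩

end Serve

theorem exists_round (s : State n m) : ∃ s', Round a b v s s' := by
  classical
  obtain ⟨M, hM⟩ := exists_isMaximumMatching a v s.active s.rest
  obtain ⟨D, hD⟩ := exists_serve (s.order.filter fun i => i ∈ s.active ∧ i ∉ M.image Prod.fst)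
      (s.rest \ M.image Prod.snd)
  refine ⟨⟨_, _, fun i => if Freezes a b v (M ∪ D) i then freezeLength a b else s.wait i - 1, _⟩,
    M, D, hM, ?_, fun i => rfl, rfl, fun i => ?_, _, List.Perm.refl _, rfl⟩
  · convert hD
  · simp

/-- Between two rounds, the bundles and the unallocated goods partition the goods, the list
contains every agent once, and nobody is frozen forever unless `b = 0`. -/
structure WellFormed (b : ℝ) (s : State n m) : Prop where
  disjoint : ∀ i j, i ≠ j → Disjoint (s.bundle i) (s.bundle j)
  disjoint_rest : ∀ i, Disjoint (s.bundle i) s.rest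
  total : ∀ g, g ∈ s.rest ∨ ∃ i, g ∈ s.bundle i
  order : s.order.Perm (List.finRange n)
  active : ∃ i, s.wait i = 0
  wait_top : ∀ i, s.wait i = ⊤ → b = 0

theorem WellFormed.nodup {s : State n m} (h : WellFormed b s) : s.order.Nodup :=
  h.order.nodup_iff.2 (List.nodup_finRange n)

theorem WellFormed.mem_order {s : State n m} (h : WellFormed b s) (i : Fin n) : i ∈ s.order :=
  h.order.mem_iff.2 (List.mem_finRange i)

theorem wellFormed_start (hn : 0 < n) : WellFormed b (start n m) where
  disjoint := by simp [start]
  disjoint_rest := by simp [start]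
  total := by simp [start]
  order := List.Perm.refl _
  active := ⟨⟨0, hn⟩, rfl⟩
  wait_top i h := by simp [start] at h

/-- The properties of a round in which the pairs `E` (agent, good received) were handed out. -/
structure RoundFacts (a b : ℝ) (v : Fin n → Fin m → ℝ) (s s' : State n m)
    (E : Finset (Fin n × Fin m)) : Prop where
  active : ∀ i g, (i, g) ∈ E → s.wait i = 0
  mem_rest : ∀ i g, (i, g) ∈ E → g ∈ s.rest
  functional : ∀ i g h, (i, g) ∈ E → (i, h) ∈ E → g = h
  inj : ∀ i j g, (i, g) ∈ E → (j, g) ∈ E → i = j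
  full : ∀ i, s.wait i = 0 → (∀ g, (i, g) ∉ E) → s'.rest = ∅
  mem_bundle : ∀ i g, g ∈ s'.bundle i ↔ g ∈ s.bundle i ∨ (i, g) ∈ E
  mem_rest' : ∀ g, g ∈ s'.rest ↔ g ∈ s.rest ∧ ∀ i, (i, g) ∉ E
  wait_freezes : ∀ i, Freezes a b v E i → s'.wait i = freezeLength a b
  wait_not_freezes : ∀ i, ¬ Freezes a b v E i → s'.wait i = s.wait i - 1
  freezes_high : ∀ i, Freezes a b v E i → ∃ g, (i, g) ∈ E ∧ v i g = a
  freezes_low : ∀ i, Freezes a b v E i → ∀ g ∈ s'.rest, v i g = b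
  low : ∀ i g, (i, g) ∈ E → v i g = b → ∀ h ∈ s'.rest, v i h = b
  before : ∀ i j g, [i, j].Sublist s.order → s.wait i = 0 → (j, g) ∈ E → v j g = b →
    ∃ h, (i, h) ∈ E
  order_perm : s'.order.Perm s.order
  order_stay : ∀ i j, [i, j].Sublist s.order → ¬ Freezes a b v E i → ¬ Freezes a b v E j →
    [i, j].Sublist s'.order
  order_move : ∀ i j, i ∈ s.order → j ∈ s.order → ¬ Freezes a b v E i → Freezes a b v E j →
    [i, j].Sublist s'.order

-- Everything about future values comes from a tight cover of the matching: outside `C`, high goods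
-- lie in `P` and disappear in this round. Recipients of low goods are outside `C`, since agents of
-- `C` are matched to high goods.
open scoped Classical in
theorem Round.facts {s s' : State n m} (hv : IsTwoValue a b v) (hs : WellFormed b s)
    (h : Round a b v s s') : ∃ E, RoundFacts a b v s s' E := by
  obtain ⟨M, D, hM, hD, hb, hr, hw, l, hl, ho⟩ := h
  obtain ⟨C, P, hc, hC, hP, hCP⟩ := hM.exists_cover
  have hab := hv.lt
  have hnd : (s.order.filter fun i => i ∈ s.active ∧ i ∉ M.image Prod.fst).Nodup :=
    hs.nodup.filter _
  have hDm := hD.mem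
  have hMm : ∀ i g, (i, g) ∈ M → s.wait i = 0 ∧ g ∈ s.rest ∧ v i g = a := by
    intro i g hig
    simpa [State.active] using hM.1.1 _ hig
  have hDm' : ∀ i g, (i, g) ∈ D →
      s.wait i = 0 ∧ (∀ h, (i, h) ∉ M) ∧ g ∈ s.rest ∧ ∀ j, (j, g) ∉ M := by
    intro i g hig
    have := hDm i g hig
    simp [State.active] at this
    tauto
  have hMf : ∀ i g h, (i, g) ∈ M → (i, h) ∈ M → g = h := fun i g h h1 h2 =>
    congrArg Prod.snd (hM.1.2 _ h1 _ h2 (Or.inl rfl))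
  have hMi : ∀ i j g, (i, g) ∈ M → (j, g) ∈ M → i = j := fun i j h h1 h2 =>
    congrArg Prod.fst (hM.1.2 _ h1 _ h2 (Or.inr rfl))
  have hfun : ∀ i g h, (i, g) ∈ M ∪ D → (i, h) ∈ M ∪ D → g = h := by
    intro i g h h1 h2
    rw [Finset.mem_union] at h1 h2
    have := hD.functional hnd i g h
    rcases h1 with h1 | h1 <;> rcases h2 with h2 | h2
    · exact hMf i g h h1 h2
    · exact ((hDm' _ _ h2).2.1 _ h1).elim
    · exact ((hDm' _ _ h1).2.1 _ h2).elim
    · exact this h1 h2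
  have hinj : ∀ i j g, (i, g) ∈ M ∪ D → (j, g) ∈ M ∪ D → i = j := by
    intro i j g h1 h2
    rw [Finset.mem_union] at h1 h2
    rcases h1 with h1 | h1 <;> rcases h2 with h2 | h2
    · exact hMi i j g h1 h2
    · exact ((hDm' _ _ h2).2.2.2 _ h1).elim
    · exact ((hDm' _ _ h1).2.2.2 _ h2).elim
    · exact hD.inj i j g h1 h2
  have hact : ∀ i g, (i, g) ∈ M ∪ D → s.wait i = 0 ∧ g ∈ s.rest := by
    intro i g h
    rcases Finset.mem_union.1 h with h | h
    · exact ⟨(hMm i g h).1, (hMm i g h).2.1⟩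
    · exact ⟨(hDm' i g h).1, (hDm' i g h).2.2.1⟩
  have hrest : ∀ g, g ∈ s'.rest ↔ g ∈ s.rest ∧ ∀ i, (i, g) ∉ M ∪ D := by
    intro g
    rw [hr]
    simp
  -- outside the cover, all goods of high value belong to the cover
  have hout : ∀ i, s.wait i = 0 → i ∉ C → ∀ g ∈ s.rest, v i g = a → g ∈ P := by
    intro i hi hiC g hg hva
    rcases hc i (by simpa [State.active] using hi) g hg hva with h | h
    · exact (hiC h).elim
    · exact h
  have hafter : ∀ i, s.wait i = 0 → i ∉ C → ∀ g ∈ s'.rest, v i g = b := by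
    intro i hi hiC g hg
    rw [hrest] at hg
    rcases hv.mem i g with h | h
    · obtain ⟨j, hj⟩ := hP g (hout i hi hiC g hg.1 h)
      exact (hg.2 j (Finset.mem_union_left _ hj)).elim
    · exact h
  have hlowC : ∀ i g, (i, g) ∈ M ∪ D → v i g = b → i ∉ C := by
    intro i g hig hvb hiC
    obtain ⟨h, hh⟩ := hC i hiC
    have h1 := hfun i g h hig (Finset.mem_union_left _ hh)
    have h2 := (hMm i h hh).2.2
    rw [h1] at hvb
    linarith
  -- A good wanted by an agent outside `C` lies in `P`, so its recipient is matched; as no edge of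
  -- the matching has both ends in the cover, she is outside `C` as well. This passes along both
  -- rules of freezing.
  have hfreeze : ∀ i, Freezes a b v (M ∪ D) i → i ∉ C ∧ ∃ g, (i, g) ∈ M := by
    have key : ∀ i j g, (i, g) ∈ M ∪ D → s.wait j = 0 → j ∉ C → v j g = a →
        i ∉ C ∧ ∃ g, (i, g) ∈ M := by
      intro i j g hig hj hjC hva
      have hgP := hout j hj hjC g (hact i g hig).2 hva
      obtain ⟨q, hq⟩ := hP g hgP
      obtain rfl := hinj i q g hig (Finset.mem_union_left _ hq)
      exact ⟨hCP i g hq hgP, g, hq⟩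
    intro i hi
    induction hi with
    | base i j g h hi hj hg hh => exact key i j g hi (hact j h hj).1 (hlowC j h hj hh) hg
    | step i j g hj hi hg ih =>
      obtain ⟨q, hq⟩ := ih.2
      exact key i j g hi (hMm j q hq).1 ih.1 hg
  refine ⟨M ∪ D, fun i g h => (hact i g h).1, fun i g h => (hact i g h).2, hfun, hinj, ?_, ?_,
    hrest, ?_, ?_, ?_, ?_, ?_, ?_, ?_, ?_, ?_⟩
  · intro i hi hno
    have hmem : i ∈ s.order.filter fun i => i ∈ s.active ∧ i ∉ M.image Prod.fst := by
      simp only [Finset.mem_union, not_or] at hno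
      simp [hs.mem_order, State.active, hi, hno]
    have hfull := hD.full i hmem (fun g hg => hno g (Finset.mem_union_right _ hg))
    rw [Finset.eq_empty_iff_forall_notMem]
    intro g hg
    rw [hrest] at hg
    obtain ⟨j, hj⟩ := hfull g (by
      simp only [Finset.mem_sdiff, hg.1, true_and, Finset.mem_image, not_exists, not_and]
      rintro ⟨j, g'⟩ hx rfl
      exact hg.2 j (Finset.mem_union_left _ hx))
    exact hg.2 j (Finset.mem_union_right _ hj)
  · intro i g
    rw [hb]
    simp
  · intro i hi
    rw [hw, if_pos hi]
  · intro i hi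
    rw [hw, if_neg hi]
  · intro i hi
    obtain ⟨_, g, hg⟩ := hfreeze i hi
    exact ⟨g, Finset.mem_union_left _ hg, (hMm i g hg).2.2⟩
  · intro i hi
    obtain ⟨h1, g, hg⟩ := hfreeze i hi
    exact hafter i (hMm i g hg).1 h1
  · intro i g hig hvb
    exact hafter i (hact i g hig).1 (hlowC i g hig hvb)
  · intro i j g hij hi hjg hvb
    by_cases hiM : ∃ h, (i, h) ∈ M
    · obtain ⟨h, hh⟩ := hiM
      exact ⟨h, Finset.mem_union_left _ hh⟩
    push Not at hiM
    have hjD : (j, g) ∈ D := by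
      rcases Finset.mem_union.1 hjg with h | h
      · have := (hMm j g h).2.2
        linarith
      · exact h
    have hsub := hij.filter fun i => decide (i ∈ s.active ∧ i ∉ M.image Prod.fst)
    have h1 : i ∈ s.active ∧ i ∉ M.image Prod.fst := by simp [State.active, hi, hiM]
    have h2 : j ∈ s.active ∧ j ∉ M.image Prod.fst := by
      obtain ⟨h1, h2, _⟩ := hDm' j g hjD
      simp [State.active, h1, h2]
    rw [List.filter_cons_of_pos (by simpa using h1), List.filter_cons_of_pos (by simpa using h2),
      List.filter_nil] at hsub
    obtain ⟨h, hh⟩ := hD.of_before hnd i j g hsub hjD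
    exact ⟨h, Finset.mem_union_right _ hh⟩
  · rw [ho]
    refine (List.Perm.append_left _ hl).trans ?_
    have := List.filter_append_perm (fun i => decide (¬ Freezes a b v (M ∪ D) i)) s.order
    simpa using this
  · intro i j hij hi hj
    rw [ho]
    refine List.Sublist.trans ?_ (List.sublist_append_left _ _)
    have := hij.filter fun i => decide (¬ Freezes a b v (M ∪ D) i)
    rwa [List.filter_cons_of_pos (by simpa using hi), List.filter_cons_of_pos (by simpa using hj),
      List.filter_nil] at this
  · intro i j hi hj hfi hfj
    rw [ho]
    refine List.Sublist.append (l₁ := [i]) (r₁ := [j]) ?_ ?_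
    · simp [hi, hfi]
    · simp [hl.mem_iff, hj, hfj]

namespace RoundFacts

variable {s s' : State n m} {E : Finset (Fin n × Fin m)}

theorem wait_top (hF : RoundFacts a b v s s' E) (hs : WellFormed b s) (i : Fin n)
    (h : s'.wait i = ⊤) : b = 0 := by
  by_cases hi : Freezes a b v E i
  · rw [hF.wait_freezes i hi] at h
    unfold freezeLength at h
    split_ifs at h with hb
    · exact hb
    · exact (ENat.natCast_ne_top _ h).elim
  · rw [hF.wait_not_freezes i hi] at h
    refine hs.wait_top i ?_
    by_contra hne
    lift s.wait i to ℕ using hne with w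
    exact ENat.natCast_ne_top (w - 1) (by exact_mod_cast h)

theorem wellFormed (hF : RoundFacts a b v s s' E) (hv : IsTwoValue a b v) (hs : WellFormed b s) :
    WellFormed b s' where
  disjoint i j hij := by
    rw [Finset.disjoint_left]
    intro g hi hj
    rw [hF.mem_bundle] at hi hj
    have h1 : ∀ i, g ∈ s.bundle i → g ∉ s.rest := fun i h =>
      Finset.disjoint_left.1 (hs.disjoint_rest i) h
    rcases hi with hi | hi <;> rcases hj with hj | hj
    · exact Finset.disjoint_left.1 (hs.disjoint i j hij) hi hj
    · exact h1 i hi (hF.mem_rest j g hj)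
    · exact h1 j hj (hF.mem_rest i g hi)
    · exact hij (hF.inj i j g hi hj)
  disjoint_rest i := by
    rw [Finset.disjoint_left]
    intro g hi hg
    rw [hF.mem_bundle] at hi
    rw [hF.mem_rest'] at hg
    rcases hi with hi | hi
    · exact Finset.disjoint_left.1 (hs.disjoint_rest i) hi hg.1
    · exact hg.2 i hi
  total g := by
    simp only [hF.mem_rest', hF.mem_bundle]
    have := hs.total g
    grind
  order := hF.order_perm.trans hs.order
  active := by
    by_cases hex : ∃ i, Freezes a b v E i
    · obtain ⟨i, hi⟩ := hex
      -- Every chain of reasons for freezing starts at a recipient of a low good. She does not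
      -- freeze herself, since only recipients of high goods do.
      obtain ⟨j, h, hj, hh⟩ : ∃ j h, (j, h) ∈ E ∧ v j h = b := by
        induction hi with
        | base i j g h hi hj hg hh => exact ⟨j, h, hj, hh⟩
        | step i j g hj hi hg ih => exact ih
      refine ⟨j, ?_⟩
      rw [hF.wait_not_freezes, hF.active j h hj]
      · rfl
      · intro hfj
        obtain ⟨g, hg, hga⟩ := hF.freezes_high j hfj
        rw [hF.functional j g h hg hj] at hga
        have := hv.lt
        linarith
    · push Not at hex
      obtain ⟨i, hi⟩ := hs.active
      exact ⟨i, by rw [hF.wait_not_freezes i (hex i), hi]; rfl⟩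
  wait_top := hF.wait_top hs

/-- An active agent either receives a good or finds none left. -/
theorem rest_ssubset (hF : RoundFacts a b v s s' E) (hs : WellFormed b s) (hne : s.rest ≠ ∅) :
    s'.rest ⊂ s.rest := by
  obtain ⟨i, hi⟩ := hs.active
  have hsub : s'.rest ⊆ s.rest := fun g hg => ((hF.mem_rest' g).1 hg).1
  by_cases hex : ∃ g, (i, g) ∈ E
  · obtain ⟨g, hg⟩ := hex
    rw [Finset.ssubset_iff_of_subset hsub]
    exact ⟨g, hF.mem_rest i g hg, fun hc => ((hF.mem_rest' g).1 hc).2 i hg⟩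
  · push Not at hex
    rw [hF.full i hi hex]
    exact Finset.empty_ssubset.2 (Finset.nonempty_iff_ne_empty.2 hne)

/-- An agent receives at most one good in a round. -/
theorem bundle_cases (hF : RoundFacts a b v s s' E) (hs : WellFormed b s) (j : Fin n) :
    ((∀ g, (j, g) ∉ E) ∧ s'.bundle j = s.bundle j) ∨
      ∃ g, (j, g) ∈ E ∧ g ∉ s.bundle j ∧ s'.bundle j = insert g (s.bundle j) := by
  by_cases hex : ∃ g, (j, g) ∈ E
  · right
    obtain ⟨g, hg⟩ := hex
    refine ⟨g, hg, fun hc => Finset.disjoint_left.1 (hs.disjoint_rest j) hc (hF.mem_rest j g hg),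
      ?_⟩
    ext h
    rw [hF.mem_bundle, Finset.mem_insert]
    have := hF.functional j g h hg
    grind
  · left
    push Not at hex
    refine ⟨hex, ?_⟩
    ext h
    simp [hF.mem_bundle, hex]

end RoundFacts

/-! ### Envy and the stages of a pair of agents -/

/-- Agent `i` does not envy agent `j` once any good is removed from the bundle of `j`. -/
def NoEnvyUpToAny (v : Fin n → Fin m → ℝ) (s : State n m) (i j : Fin n) : Prop :=
  ∀ g ∈ s.bundle j, value v i (s.bundle j \ {g}) ≤ value v i (s.bundle i)

theorem value_insert {i : Fin n} {g : Fin m} {B : Finset (Fin m)} (h : g ∉ B) :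
    value v i (insert g B) = value v i B + v i g := by
  unfold value
  rw [Finset.sum_insert h, add_comm]

theorem IsTwoValue.le (hv : IsTwoValue a b v) (i : Fin n) (g : Fin m) : v i g ≤ a := by
  have := hv.lt
  rcases hv.mem i g with h | h <;> linarith

theorem IsTwoValue.ge (hv : IsTwoValue a b v) (i : Fin n) (g : Fin m) : b ≤ v i g := by
  have := hv.lt
  rcases hv.mem i g with h | h <;> linarith

theorem value_le_card (hv : IsTwoValue a b v) (i : Fin n) (B : Finset (Fin m)) :
    value v i B ≤ B.card * a := by
  unfold value
  calc _ ≤ ∑ g ∈ B, a := Finset.sum_le_sum fun g _ => hv.le i g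
    _ = _ := by simp

/-- The removed good is worth at least `b`. -/
theorem noEnvy_of_value_le (hv : IsTwoValue a b v) {s : State n m} {i j : Fin n}
    (h : value v i (s.bundle j) ≤ value v i (s.bundle i) + b) : NoEnvyUpToAny v s i j := by
  intro g hg
  have h1 : value v i (s.bundle j \ {g}) + v i g = value v i (s.bundle j) := by
    rw [← value_insert (by simp), Finset.sdiff_singleton_eq_erase, Finset.insert_erase hg]
  have := hv.ge i g
  linarith

/-- At most `r` goods are left after the removal, each worth at most `a`. -/
theorem noEnvy_of_card_le (hv : IsTwoValue a b v) {s : State n m} {i j : Fin n} {r : ℕ}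
    (hr : r * a ≤ value v i (s.bundle i)) (h : (s.bundle j).card ≤ r + 1) :
    NoEnvyUpToAny v s i j := by
  intro g hg
  have h1 := value_le_card hv i (s.bundle j \ {g})
  rw [Finset.sdiff_singleton_eq_erase] at h1 ⊢
  have h2 := Finset.card_erase_of_mem hg
  have h3 : (((s.bundle j).erase g).card : ℝ) ≤ r := by
    exact_mod_cast (by omega : ((s.bundle j).erase g).card ≤ r)
  have h4 : 0 ≤ a := by linarith [hv.nonneg, hv.lt]
  nlinarith

/-- The four stages in the relation of agent `i` to agent `j`. -/
inductive Stage (a b : ℝ) (v : Fin n → Fin m → ℝ) (s : State n m) (i j : Fin n) (t : ℕ) : Prop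
  | early (hi : s.wait i = 0) (hx : value v i (s.bundle i) = t * a)
      (hj : (s.bundle j).card ≤ t)
  | ahead (low : ∀ g ∈ s.rest, v i g = b)
      (h : value v i (s.bundle j) + b * (s.wait i).toNat ≤ value v i (s.bundle i))
  | together (low : ∀ g ∈ s.rest, v i g = b) (low' : ∀ g ∈ s.rest, v j g = b)
      (hw : s.wait i = s.wait j)
      (h : value v i (s.bundle j) ≤ value v i (s.bundle i))
  | behind (hi : s.wait i = 0) (low : ∀ g ∈ s.rest, v i g = b) (low' : ∀ g ∈ s.rest, v j g = b)
      (order : [i, j].Sublist s.order)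
      (h : s.wait j ≠ ⊤ → value v i (s.bundle j) ≤
        value v i (s.bundle i) + b + b * (s.wait j).toNat)
      (h' : s.wait j ≠ 0 → ∃ r : ℕ, r * a ≤ value v i (s.bundle i) ∧ (s.bundle j).card ≤ r + 1)

/-- Only in the early stage, and while `j` is frozen in the stage `behind`, can the lead of `j`
exceed `b`; there the number of goods is used instead. -/
theorem Stage.noEnvy (hv : IsTwoValue a b v) {s : State n m} {i j : Fin n} {t : ℕ}
    (h : Stage a b v s i j t) : NoEnvyUpToAny v s i j := by
  have hb := hv.nonneg
  cases h with
  | early hi hx hj => exact noEnvy_of_card_le hv hx.ge (by omega)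
  | ahead low h =>
    refine noEnvy_of_value_le hv ?_
    have : 0 ≤ b * (s.wait i).toNat := by positivity
    linarith
  | together low low' hw h => exact noEnvy_of_value_le hv (by linarith)
  | behind hi low low' order h h' =>
    by_cases hw : s.wait j = 0
    · refine noEnvy_of_value_le hv ?_
      have := h (by simp [hw])
      simpa [hw] using this
    · obtain ⟨r, h1, h2⟩ := h' hw
      exact noEnvy_of_card_le hv h1 h2

/-- A lead of `a - b` pays for all low goods missed during a freeze. For `b = 0` the junk value
`⊤.toNat = 0` does no harm. -/
theorem freezeLength_mul_le (hb : 0 ≤ b) (hab : b < a) :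
    b * (freezeLength a b).toNat + b ≤ a := by
  unfold freezeLength
  split_ifs with h
  · simp [h]; linarith
  · have hb' : 0 < b := lt_of_le_of_ne hb (Ne.symm h)
    have h1 : (1 : ℝ) < a / b := by rwa [lt_div_iff₀ hb', one_mul]
    have h2 := Nat.floor_le (by linarith : 0 ≤ a / b - 1)
    rw [ENat.toNat_natCast]
    have h3 : b * (⌊a / b - 1⌋₊ : ℝ) ≤ b * (a / b - 1) := by gcongr
    have h4 : b * (a / b) = a := by field_simp
    nlinarith

/-- A lead of `a - b` has shrunk below `b` when a finite freeze ends. -/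
theorem lt_freezeLength_mul (hb : 0 ≤ b) (h : freezeLength a b ≠ ⊤) :
    a < b * (freezeLength a b).toNat + 2 * b := by
  unfold freezeLength at h ⊢
  split_ifs with h0
  · simp [h0] at h
  · have hb' : 0 < b := lt_of_le_of_ne hb (Ne.symm h0)
    have h2 := Nat.lt_floor_add_one (a / b - 1)
    rw [ENat.toNat_natCast]
    have h3 : b * (a / b - 1) < b * ((⌊a / b - 1⌋₊ : ℝ) + 1) := by gcongr
    have h4 : b * (a / b) = a := by field_simp
    nlinarith

theorem toNat_sub_one (w : ℕ∞) : (w - 1).toNat = w.toNat - 1 := by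
  induction w with
  | top => rfl
  | coe w => norm_cast

end MatchFreeze

/-! ### How a round changes the stage -/

namespace MatchFreeze

variable {n m : ℕ} {a b : ℝ} {v : Fin n → Fin m → ℝ}

namespace RoundFacts

variable {s s' : State n m} {E : Finset (Fin n × Fin m)} {i j : Fin n} {t : ℕ}

theorem value_of_notMem (hF : RoundFacts a b v s s' E) (hs : WellFormed b s)
    (h : ∀ g, (j, g) ∉ E) (i : Fin n) : s'.bundle j = s.bundle j ∧
      value v i (s'.bundle j) = value v i (s.bundle j) := by
  rcases hF.bundle_cases hs j with ⟨_, h2⟩ | ⟨g, hg, _⟩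
  · rw [h2]; exact ⟨rfl, rfl⟩
  · exact (h g hg).elim

theorem value_of_mem (hF : RoundFacts a b v s s' E) (hs : WellFormed b s) {g : Fin m}
    (h : (j, g) ∈ E) (i : Fin n) : (s'.bundle j).card = (s.bundle j).card + 1 ∧
      value v i (s'.bundle j) = value v i (s.bundle j) + v i g := by
  rcases hF.bundle_cases hs j with ⟨h1, _⟩ | ⟨g', hg, h2, h3⟩
  · exact (h1 g h).elim
  · obtain rfl := hF.functional j g g' h hg
    rw [h3, value_insert h2, Finset.card_insert_of_notMem h2]
    exact ⟨rfl, rfl⟩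

theorem value_le_of_low (hF : RoundFacts a b v s s' E) (hs : WellFormed b s) (hb : 0 ≤ b)
    (low : ∀ g ∈ s.rest, v i g = b) (j : Fin n) :
    value v i (s.bundle j) ≤ value v i (s'.bundle j) ∧
      value v i (s'.bundle j) ≤ value v i (s.bundle j) + b := by
  by_cases h : ∃ g, (j, g) ∈ E
  · obtain ⟨g, hg⟩ := h
    rw [(hF.value_of_mem hs hg i).2, low g (hF.mem_rest j g hg)]
    constructor <;> linarith
  · push Not at h
    rw [(hF.value_of_notMem hs h i).2]
    constructor <;> linarith

/-- Freezing requires a good worth `a` in the same round. Since only low goods remain for an agent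
who has frozen, nobody freezes twice. -/
theorem not_freezes_of_low (hF : RoundFacts a b v s s' E) (hab : b < a)
    (low : ∀ g ∈ s.rest, v i g = b) : ¬ Freezes a b v E i := by
  intro h
  obtain ⟨g, hg, hva⟩ := hF.freezes_high i h
  have := low g (hF.mem_rest i g hg)
  linarith

theorem low_of_low (hF : RoundFacts a b v s s' E) (low : ∀ g ∈ s.rest, v i g = b) :
    ∀ g ∈ s'.rest, v i g = b := fun g hg => low g ((hF.mem_rest' g).1 hg).1

/-- If `i` gets a high good and freezes, then either `j` got a good worth `a` to `i` and freezes
with her, or `i` leads by `a - b`. If `i` gets a low good, then either `j` got a good worth `a` to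
`i` and freezes, or the gain of `j` is at most `b` too. A high good without freezing continues the
stage, and if `i` gets nothing the algorithm ends and counting applies. -/
theorem stage_early (hF : RoundFacts a b v s s' E) (hv : IsTwoValue a b v)
    (hs : WellFormed b s) (hi : s.wait i = 0) (hx : value v i (s.bundle i) = t * a)
    (hj : (s.bundle j).card ≤ t) :
    Stage a b v s' i j (t + 1) ∨ s'.rest = ∅ ∧ NoEnvyUpToAny v s' i j := by
  have hb := hv.nonneg
  have hab := hv.lt
  have hy := (value_le_card hv i (s.bundle j)).trans
    (mul_le_mul_of_nonneg_right (Nat.cast_le.2 hj) (hb.trans hab.le))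
  have hcard : (s'.bundle j).card ≤ t + 1 := by
    by_cases h : ∃ g, (j, g) ∈ E
    · obtain ⟨g, hg⟩ := h
      rw [(hF.value_of_mem hs hg i).1]
      omega
    · push Not at h
      rw [(hF.value_of_notMem hs h i).1]
      omega
  have hy' := (value_le_card hv i (s'.bundle j)).trans
    (mul_le_mul_of_nonneg_right (Nat.cast_le.2 hcard) (hb.trans hab.le))
  push_cast at hy'
  -- the value of the bundle of `j` when `j` receives nothing that is worth `a`
  have hyb : (∀ h, (j, h) ∈ E → v i h = b) → value v i (s'.bundle j) ≤ t * a + b := by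
    intro hjb
    by_cases h : ∃ g, (j, g) ∈ E
    · obtain ⟨g, hg⟩ := h
      rw [(hF.value_of_mem hs hg i).2, hjb g hg]
      linarith
    · push Not at h
      rw [(hF.value_of_notMem hs h i).2]
      linarith
  by_cases hex : ∃ g, (i, g) ∈ E
  swap
  · push Not at hex
    right
    refine ⟨hF.full i hi hex, noEnvy_of_card_le hv ?_ hcard⟩
    rw [(hF.value_of_notMem hs hex i).2, hx]
  left
  obtain ⟨g, hg⟩ := hex
  have hxv := (hF.value_of_mem hs hg i).2
  rw [hx] at hxv
  rcases hv.mem i g with hva | hvb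
  · by_cases hfi : Freezes a b v E i
    · have hwi := hF.wait_freezes i hfi
      by_cases hja : ∃ h, (j, h) ∈ E ∧ v i h = a
      · obtain ⟨h, hh, hha⟩ := hja
        have hfj : Freezes a b v E j := .step j i h hfi hh hha
        refine .together (hF.freezes_low i hfi) (hF.freezes_low j hfj) ?_ ?_
        · rw [hwi, hF.wait_freezes j hfj]
        · linarith
      · push Not at hja
        have := hyb fun h hh => (hv.mem i h).resolve_left (hja h hh)
        refine .ahead (hF.freezes_low i hfi) ?_
        have := freezeLength_mul_le hb hab
        rw [hwi]
        linarith
    · refine .early ?_ ?_ hcard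
      · rw [hF.wait_not_freezes i hfi, hi]
        rfl
      · push_cast
        linarith
  · have hfi : ¬ Freezes a b v E i := by
      intro hfi
      obtain ⟨h, hh, hha⟩ := hF.freezes_high i hfi
      rw [hF.functional i h g hh hg] at hha
      linarith
    have hwi : s'.wait i = 0 := by
      rw [hF.wait_not_freezes i hfi, hi]
      rfl
    have hlow := hF.low i g hg hvb
    by_cases hja : ∃ h, (j, h) ∈ E ∧ v i h = a
    · obtain ⟨h, hh, hha⟩ := hja
      have hfj : Freezes a b v E j := .base j i h g hh hg hha hvb
      -- The freeze moves `j` behind `i` in the list. Counting goods applies with `r = t` until she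
      -- returns.
      refine .behind hwi hlow (hF.freezes_low j hfj)
        (hF.order_move i j (hs.mem_order i) (hs.mem_order j) hfi hfj) ?_ ?_
      · rw [hF.wait_freezes j hfj]
        intro hne
        have := lt_freezeLength_mul hb hne
        linarith
      · intro _
        exact ⟨t, by linarith, hcard⟩
    · push Not at hja
      have := hyb fun h hh => (hv.mem i h).resolve_left (hja h hh)
      refine .ahead hlow ?_
      rw [hwi]
      simp
      linarith

/-- A round missed while frozen costs `i` at most `b` relative to `j`, and the required reserve
shrinks by the same amount. Once active, `i` gains `b` in each round, except when the goods run out,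
and then the deficit is at most `b`. -/
theorem stage_ahead (hF : RoundFacts a b v s s' E) (hv : IsTwoValue a b v)
    (hs : WellFormed b s) (low : ∀ g ∈ s.rest, v i g = b)
    (h : value v i (s.bundle j) + b * (s.wait i).toNat ≤ value v i (s.bundle i)) :
    Stage a b v s' i j (t + 1) ∨ s'.rest = ∅ ∧ NoEnvyUpToAny v s' i j := by
  have hb := hv.nonneg
  obtain ⟨h1, _⟩ := hF.value_le_of_low hs hb low i
  obtain ⟨_, h2⟩ := hF.value_le_of_low hs hb low j
  have hw := hF.wait_not_freezes i (hF.not_freezes_of_low hv.lt low)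
  by_cases hi : s.wait i = 0
  · rw [hi] at h
    simp at h
    by_cases hex : ∃ g, (i, g) ∈ E
    · obtain ⟨g, hg⟩ := hex
      left
      refine .ahead (hF.low_of_low low) ?_
      rw [hw, hi, (hF.value_of_mem hs hg i).2, low g (hF.mem_rest i g hg)]
      simp
      linarith
    · push Not at hex
      exact .inr ⟨hF.full i hi hex, noEnvy_of_value_le hv (by linarith)⟩
  · left
    refine .ahead (hF.low_of_low low) ?_
    rw [hw, toNat_sub_one]
    -- An infinite freeze only occurs for `b = 0`, where no reserve is needed.
    by_cases htop : s.wait i = ⊤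
    · have := hs.wait_top i htop
      subst this
      simp at h ⊢
      linarith
    · have hpos : 1 ≤ (s.wait i).toNat := by
        rw [Nat.one_le_iff_ne_zero, ne_eq, ENat.toNat_eq_zero]
        tauto
      push_cast [hpos]
      linarith

/-- Neither agent receives anything while both are frozen; when they return, the comparison is that
of `ahead` with no reserve. -/
theorem stage_together (hF : RoundFacts a b v s s' E) (hv : IsTwoValue a b v)
    (hs : WellFormed b s) (low : ∀ g ∈ s.rest, v i g = b) (low' : ∀ g ∈ s.rest, v j g = b)
    (hw : s.wait i = s.wait j) (h : value v i (s.bundle j) ≤ value v i (s.bundle i)) :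
    Stage a b v s' i j (t + 1) ∨ s'.rest = ∅ ∧ NoEnvyUpToAny v s' i j := by
  by_cases hi : s.wait i = 0
  · exact hF.stage_ahead hv hs low (by simpa [hi] using h)
  · left
    have hno : ∀ k, s.wait k = s.wait i → ∀ g, (k, g) ∉ E := fun k hk g hg =>
      hi (hk ▸ hF.active k g hg)
    refine .together (hF.low_of_low low) (hF.low_of_low low') ?_ ?_
    · rw [hF.wait_not_freezes i (hF.not_freezes_of_low hv.lt low), 
        hF.wait_not_freezes j (hF.not_freezes_of_low hv.lt low'), hw]
    · rwa [(hF.value_of_notMem hs (hno i rfl) i).2, (hF.value_of_notMem hs (hno j hw.symm) i).2]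

/-- While `j` is frozen, `i` catches up by `b` per round, in step with the waiting time. When both
are active and `i` is served, the gain of `j` does not exceed that of `i`. An infinite wait gives no
bound on the values, so only the count of goods is carried along then. -/
theorem stage_behind (hF : RoundFacts a b v s s' E) (hv : IsTwoValue a b v)
    (hs : WellFormed b s) (hi : s.wait i = 0) (low : ∀ g ∈ s.rest, v i g = b)
    (low' : ∀ g ∈ s.rest, v j g = b) (order : [i, j].Sublist s.order)
    (h : s.wait j ≠ ⊤ → value v i (s.bundle j) ≤
      value v i (s.bundle i) + b + b * (s.wait j).toNat)
    (h' : s.wait j ≠ 0 → ∃ r : ℕ, r * a ≤ value v i (s.bundle i) ∧ (s.bundle j).card ≤ r + 1) :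
    Stage a b v s' i j (t + 1) ∨ s'.rest = ∅ ∧ NoEnvyUpToAny v s' i j := by
  have hb := hv.nonneg
  obtain ⟨h1, _⟩ := hF.value_le_of_low hs hb low i
  obtain ⟨_, h2⟩ := hF.value_le_of_low hs hb low j
  have hfi := hF.not_freezes_of_low hv.lt low
  have hfj := hF.not_freezes_of_low hv.lt low'
  have hwi := hF.wait_not_freezes i hfi
  have hwj := hF.wait_not_freezes j hfj
  have hwait : s.wait j ≠ 0 → ∃ r : ℕ, r * a ≤ value v i (s'.bundle i) ∧
      (s'.bundle j).card ≤ r + 1 := by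
    intro hj
    obtain ⟨r, hr1, hr2⟩ := h' hj
    have hno : ∀ g, (j, g) ∉ E := fun g hg => hj (hF.active j g hg)
    refine ⟨r, hr1.trans h1, ?_⟩
    rwa [(hF.value_of_notMem hs hno i).1]
  by_cases hex : ∃ g, (i, g) ∈ E
  · left
    obtain ⟨g, hg⟩ := hex
    have hx := (hF.value_of_mem hs hg i).2
    rw [low g (hF.mem_rest i g hg)] at hx
    refine .behind ?_ (hF.low_of_low low) (hF.low_of_low low')
      (hF.order_stay i j order hfi hfj) ?_ ?_
    · rw [hwi, hi]
      rfl
    · intro hne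
      rw [hwj, toNat_sub_one]
      have htop : s.wait j ≠ ⊤ := by
        intro htop
        rw [hwj, htop] at hne
        exact hne rfl
      have h3 := h htop
      by_cases hj : s.wait j = 0
      · rw [hj] at h3
        simp [hj] at h3 ⊢
        linarith
      · have hpos : 1 ≤ (s.wait j).toNat := by
          rw [Nat.one_le_iff_ne_zero, ne_eq, ENat.toNat_eq_zero]
          tauto
        have hno : ∀ g, (j, g) ∉ E := fun g hg => hj (hF.active j g hg)
        rw [(hF.value_of_notMem hs hno i).2]
        push_cast [hpos]
        linarith
    · intro hj
      refine hwait fun hc => hj ?_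
      rw [hwj, hc]
      rfl
  · push Not at hex
    right
    refine ⟨hF.full i hi hex, ?_⟩
    by_cases hj : s.wait j = 0
    -- Only low goods are left for `j`, and `i` precedes her in the list, so she cannot be served
    -- when `i` is not.
    · have hno : ∀ g, (j, g) ∉ E := by
        intro g hg
        obtain ⟨k, hk⟩ := hF.before i j g order hi hg (low' g (hF.mem_rest j g hg))
        exact hex k hk
      have h3 := h (by simp [hj])
      refine noEnvy_of_value_le hv ?_
      rw [(hF.value_of_notMem hs hno i).2, (hF.value_of_notMem hs hex i).2]
      simpa [hj] using h3
    · obtain ⟨r, hr1, hr2⟩ := hwait hj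
      exact noEnvy_of_card_le hv hr1 hr2

theorem stage (hF : RoundFacts a b v s s' E) (hv : IsTwoValue a b v) (hs : WellFormed b s)
    (h : Stage a b v s i j t) :
    Stage a b v s' i j (t + 1) ∨ s'.rest = ∅ ∧ NoEnvyUpToAny v s' i j := by
  cases h with
  | early hi hx hj => exact hF.stage_early hv hs hi hx hj
  | ahead low h => exact hF.stage_ahead hv hs low h
  | together low low' hw h => exact hF.stage_together hv hs low low' hw h
  | behind hi low low' order h h' => exact hF.stage_behind hv hs hi low low' order h h'

end RoundFacts

/-! ### Termination and fairness of executions -/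

namespace IsExecution

variable {S : ℕ → State n m} {K : ℕ}

theorem wellFormed (hn : 0 < n) (hv : IsTwoValue a b v) (h : IsExecution a b v S K) :
    ∀ t ≤ K, WellFormed b (S t) := by
  intro t ht
  induction t with
  | zero => rw [h.1]; exact wellFormed_start hn
  | succ t ih =>
    have hs := ih (by omega)
    obtain ⟨E, hF⟩ := (h.2 t (by omega)).2.facts hv hs
    exact hF.wellFormed hv hs

theorem card_rest_add_le (hn : 0 < n) (hv : IsTwoValue a b v) (h : IsExecution a b v S K) :
    ∀ t ≤ K, (S t).rest.card + t ≤ m := by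
  intro t ht
  induction t with
  | zero => rw [h.1]; simp [start]
  | succ t ih =>
    have hs := h.wellFormed hn hv t (by omega)
    obtain ⟨E, hF⟩ := (h.2 t (by omega)).2.facts hv hs
    have := Finset.card_lt_card (hF.rest_ssubset hs (h.2 t (by omega)).1)
    have := ih (by omega)
    omega

/-- The second alternative can only appear at the end, since a further round requires unallocated
goods. -/
theorem stage (hn : 0 < n) (hv : IsTwoValue a b v) (h : IsExecution a b v S K) (i j : Fin n) :
    ∀ t ≤ K, Stage a b v (S t) i j t ∨ (S t).rest = ∅ ∧ NoEnvyUpToAny v (S t) i j := by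
  intro t ht
  induction t with
  | zero =>
    left
    rw [h.1]
    exact .early rfl (by simp [start, value]) (by simp [start])
  | succ t ih =>
    have hs := h.wellFormed hn hv t (by omega)
    obtain ⟨hne, hr⟩ := h.2 t (by omega)
    obtain ⟨E, hF⟩ := hr.facts hv hs
    rcases ih (by omega) with h1 | h1
    · exact hF.stage hv hs h1
    · exact (hne h1.1).elim

theorem isEFX0 (hn : 0 < n) (hv : IsTwoValue a b v) (h : IsExecution a b v S K) :
    IsEFX0 v (S K).bundle := by
  intro i j
  rcases h.stage hn hv i j K le_rfl with h1 | h1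
  · exact h1.noEnvy hv
  · exact h1.2

theorem isAllocation (hn : 0 < n) (hv : IsTwoValue a b v) (h : IsExecution a b v S K)
    (hrest : (S K).rest = ∅) : IsAllocation (S K).bundle := by
  have hs := h.wellFormed hn hv K le_rfl
  refine ⟨hs.disjoint, fun g => ?_⟩
  have := hs.total g
  simpa [hrest] using this

end IsExecution

end MatchFreeze

/-! ### A weakest precondition calculus with step bounds -/

namespace MatchFreeze

@[simp]
theorem Memory.setNat_nat (σ : Memory) (x y k x' : ℕ) :
    (σ.setNat x y k).nat x' = if x' = x then Function.update (σ.nat x) y k else σ.nat x' := by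
  funext y'
  unfold Memory.setNat
  by_cases hx : x' = x
  · subst hx
    by_cases hy : y' = y <;> simp [hy]
  · simp [hx]

@[simp]
theorem Memory.setNat_real (σ : Memory) (x y k : ℕ) : (σ.setNat x y k).real = σ.real := rfl

@[simp]
theorem Memory.setReal_nat (σ : Memory) (x y : ℕ) (r : ℝ) : (σ.setReal x y r).nat = σ.nat := rfl

theorem Memory.setReal_real (σ : Memory) (x y : ℕ) (r : ℝ) (x' y' : ℕ) :
    (σ.setReal x y r).real x' y' = if x' = x ∧ y' = y then r else σ.real x' y' := rfl

attribute [simp] NatExp.eval RealExp.eval Test.Holds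

/-- The cell `(x, 0)`, used as a variable. -/
def NatExp.var (x : ℕ) : NatExp := .cell (.const x) (.const 0)

/-- The entry with index `e` of the array in row `x`. -/
def NatExp.entry (x : ℕ) (e : NatExp) : NatExp := .cell (.const x) e

@[simp]
theorem NatExp.eval_var (σ : Memory) (x : ℕ) : (NatExp.var x).eval σ = σ.nat x 0 := rfl

@[simp]
theorem NatExp.eval_entry (σ : Memory) (x : ℕ) (e : NatExp) :
    (NatExp.entry x e).eval σ = σ.nat x (e.eval σ) := rfl

/-- Disjunction of tests. -/
def Test.or (c d : Test) : Test := .not (.and (.not c) (.not d))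

/-- Equality of natural numbers. -/
def Test.natEq (e f : NatExp) : Test := .and (.not (.natLt e f)) (.not (.natLt f e))

@[simp]
theorem Test.holds_or (σ : Memory) (c d : Test) :
    (Test.or c d).Holds σ ↔ c.Holds σ ∨ d.Holds σ := by
  simp only [Test.or, Test.Holds]
  tauto

@[simp]
theorem Test.holds_natEq (σ : Memory) (e f : NatExp) :
    (Test.natEq e f).Holds σ ↔ e.eval σ = f.eval σ := by
  simp only [Test.natEq, Test.Holds]
  omega

namespace Program

/-- Assignment to an entry of the array in row `x`. -/
def assign (x : ℕ) (y e : NatExp) : Program := .setNat (.const x) y e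

/-- The loop with test `t` reaches a memory with `Q` after exactly `k` runs of the body, whose
weakest precondition is `W`. -/
def iterate (t : Test) (W : (Memory → Prop) → Memory → Prop) (Q : Memory → Prop) :
    ℕ → Memory → Prop
  | 0 => fun σ => ¬ t.Holds σ ∧ Q σ
  | k + 1 => fun σ => t.Holds σ ∧ W (iterate t W Q k) σ

/-- Weakest precondition: started on `σ`, the program halts with a memory that satisfies `Q`, and
each loop that is entered runs its body at most `B` times. -/
def WP (B : ℕ) : Program → (Memory → Prop) → Memory → Prop
  | .skip, Q, σ => Q σ
  | .setNat x y e, Q, σ => Q (σ.setNat (x.eval σ) (y.eval σ) (e.eval σ))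
  | .setReal x y e, Q, σ => Q (σ.setReal (x.eval σ) (y.eval σ) (e.eval σ))
  | .seq c d, Q, σ => WP B c (WP B d Q) σ
  | .ite t c d, Q, σ => (t.Holds σ → WP B c Q σ) ∧ (¬ t.Holds σ → WP B d Q σ)
  | .loop t c, Q, σ => ∃ k ≤ B, iterate t (WP B c) Q k σ

/-- The number of steps of a program whose loops run their bodies at most `X` times. -/
noncomputable def bound : Program → Polynomial ℕ
  | .skip => 1
  | .setNat x y e => (x.cost + y.cost + e.cost + 1 : ℕ)
  | .setReal x y e => (x.cost + y.cost + e.cost + 1 : ℕ)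
  | .seq c d => bound c + bound d
  | .ite t c d => (t.cost : ℕ) + (bound c + bound d) + 1
  | .loop t c => (.X + 1) * ((t.cost : ℕ) + bound c + 1)

variable {B : ℕ} {c d : Program} {Q Q' : Memory → Prop} {σ : Memory}

/-- The bound is independent of the memory: each nested loop contributes a factor `B + 1`, so the
program alone determines the polynomial. -/
theorem WP.exec (h : c.WP B Q σ) :
    ∃ k τ, Exec c σ k τ ∧ k ≤ c.bound.eval B ∧ Q τ := by
  induction c generalizing Q σ with
  | skip => exact ⟨_, _, .skip σ, by simp [bound], h⟩
  | setNat x y e =>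
    refine ⟨_, _, .setNat x y e σ, ?_, h⟩
    rw [bound, Polynomial.eval_natCast]
    rfl
  | setReal x y e =>
    refine ⟨_, _, .setReal x y e σ, ?_, h⟩
    rw [bound, Polynomial.eval_natCast]
    rfl
  | seq c d ihc ihd =>
    obtain ⟨k, ρ, h1, h2, h3⟩ := ihc h
    obtain ⟨l, τ, h4, h5, h6⟩ := ihd h3
    exact ⟨_, _, .seq c d σ ρ τ k l h1 h4, by simp only [bound, Polynomial.eval_add]; omega, h6⟩
  | ite t c d ihc ihd =>
    by_cases ht : t.Holds σ
    · obtain ⟨k, τ, h1, h2, h3⟩ := ihc (h.1 ht)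
      refine ⟨_, _, .iteTrue t c d σ τ k ht h1, ?_, h3⟩
      simp only [bound, Polynomial.eval_add, Polynomial.eval_natCast, Polynomial.eval_one,
        Nat.cast_id]
      omega
    · obtain ⟨k, τ, h1, h2, h3⟩ := ihd (h.2 ht)
      refine ⟨_, _, .iteFalse t c d σ τ k ht h1, ?_, h3⟩
      simp only [bound, Polynomial.eval_add, Polynomial.eval_natCast, Polynomial.eval_one,
        Nat.cast_id]
      omega
  | loop t c ih =>
    obtain ⟨N, hN, h⟩ := h
    have key : ∀ N σ, iterate t (WP B c) Q N σ → ∃ k τ, Exec (.loop t c) σ k τ ∧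
        k ≤ (N + 1) * (t.cost + c.bound.eval B + 1) ∧ Q τ := by
      intro N
      induction N with
      | zero =>
        intro σ h
        exact ⟨_, _, .loopFalse t c σ h.1, by simp, h.2⟩
      | succ N ihN =>
        intro σ h
        obtain ⟨k, ρ, h1, h2, h3⟩ := ih h.2
        obtain ⟨l, τ, h4, h5, h6⟩ := ihN ρ h3
        refine ⟨_, _, .loopTrue t c σ ρ τ k l h.1 h1 h4, ?_, h6⟩
        rw [Nat.add_mul (N + 1)]
        omega
    obtain ⟨k, τ, h1, h2, h3⟩ := key N σ h
    refine ⟨k, τ, h1, h2.trans ?_, h3⟩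
    simp only [bound, Polynomial.eval_mul, Polynomial.eval_add, Polynomial.eval_natCast,
      Polynomial.eval_one, Polynomial.eval_X, Nat.cast_id]
    gcongr

/-- The program does not write to the natural number cells in row `r`. -/
def keeps (r : ℕ) : Program → Bool
  | .skip => true
  | .setNat (.const x) _ _ => x != r
  | .setNat _ _ _ => false
  | .setReal _ _ _ => true
  | .seq c d => keeps r c && keeps r d
  | .ite _ c d => keeps r c && keeps r d
  | .loop _ c => keeps r c

/-- The program does not write to real cells. -/
def keepsReal : Program → Bool
  | .skip => true
  | .setNat _ _ _ => true
  | .setReal _ _ _ => false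
  | .seq c d => keepsReal c && keepsReal d
  | .ite _ c d => keepsReal c && keepsReal d
  | .loop _ c => keepsReal c

/-- The memories `σ` and `τ` agree where the program `c` does not write. -/
structure Frame (c : Program) (σ τ : Memory) : Prop where
  nat : ∀ r, c.keeps r = true → τ.nat r = σ.nat r
  real : c.keepsReal = true → τ.real = σ.real

theorem Frame.refl (c : Program) (σ : Memory) : Frame c σ σ := ⟨fun _ _ => rfl, fun _ => rfl⟩

theorem Frame.trans {σ ρ τ : Memory} (h : Frame c σ ρ) (h' : Frame c ρ τ) : Frame c σ τ :=
  ⟨fun r hr => (h'.nat r hr).trans (h.nat r hr), fun hr => (h'.real hr).trans (h.real hr)⟩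

theorem Frame.weaken {σ τ : Memory} (h : Frame c σ τ)
    (hn : ∀ r, d.keeps r = true → c.keeps r = true)
    (hr : d.keepsReal = true → c.keepsReal = true) : Frame d σ τ :=
  ⟨fun r h' => h.nat r (hn r h'), fun h' => h.real (hr h')⟩

theorem WP.mono (h : c.WP B Q σ) (hQ : ∀ τ, Q τ → Q' τ) : c.WP B Q' σ := by
  induction c generalizing Q Q' σ with
  | skip => exact hQ _ h
  | setNat x y e => exact hQ _ h
  | setReal x y e => exact hQ _ h
  | seq c d ihc ihd => exact ihc h fun ρ hρ => ihd hρ hQ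
  | ite t c d ihc ihd => exact ⟨fun ht => ihc (h.1 ht) hQ, fun ht => ihd (h.2 ht) hQ⟩
  | loop t c ih =>
    obtain ⟨N, hN, h⟩ := h
    refine ⟨N, hN, ?_⟩
    clear hN
    induction N generalizing σ with
    | zero => exact ⟨h.1, hQ _ h.2⟩
    | succ N ihN => exact ⟨h.1, ih h.2 fun ρ hρ => ihN hρ⟩

/-- A frame rule: specifications need to mention only the rows that change, and everything else
follows from the syntactic check `keeps`. -/
theorem WP.and_frame (h : c.WP B Q σ) : c.WP B (fun τ => Q τ ∧ Frame c σ τ) σ := by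
  induction c generalizing Q σ with
  | skip => exact ⟨h, .refl _ _⟩
  | setNat x y e =>
    refine ⟨h, fun r hr => ?_, fun _ => rfl⟩
    cases x <;> simp [keeps] at hr ⊢
    exact fun h => (hr h.symm).elim
  | setReal x y e => exact ⟨h, fun r hr => rfl, fun hr => by simp [keepsReal] at hr⟩
  | seq c d ihc ihd =>
    refine (ihc h).mono fun ρ hρ => (ihd hρ.1).mono fun τ hτ => ⟨hτ.1, ?_⟩
    refine (hρ.2.weaken ?_ ?_).trans (hτ.2.weaken ?_ ?_) <;> simp +contextual [keeps, keepsReal]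
  | ite t c d ihc ihd =>
    refine ⟨fun ht => (ihc (h.1 ht)).mono fun τ hτ => ⟨hτ.1, ?_⟩,
      fun ht => (ihd (h.2 ht)).mono fun τ hτ => ⟨hτ.1, ?_⟩⟩ <;>
    refine hτ.2.weaken ?_ ?_ <;> simp +contextual [keeps, keepsReal]
  | loop t c ih =>
    obtain ⟨N, hN, h⟩ := h
    refine ⟨N, hN, ?_⟩
    clear hN
    induction N generalizing σ with
    | zero => exact ⟨h.1, h.2, .refl _ _⟩
    | succ N ihN =>
      refine ⟨h.1, (ih h.2).mono fun ρ hρ => ?_⟩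
      have hρσ : Frame (.loop t c) σ ρ := hρ.2.weaken (fun _ h => h) (fun h => h)
      have key : ∀ N ρ', iterate t (WP B c) (fun τ => Q τ ∧ Frame (.loop t c) ρ τ) N ρ' →
          iterate t (WP B c) (fun τ => Q τ ∧ Frame (.loop t c) σ τ) N ρ' := by
        intro N
        induction N with
        | zero => exact fun ρ' h => ⟨h.1, h.2.1, hρσ.trans h.2.2⟩
        | succ N ihN => exact fun ρ' h => ⟨h.1, h.2.mono fun τ hτ => ihN τ hτ⟩
      exact key _ _ (ihN hρ.1)

theorem WP.mono_frame (h : c.WP B Q σ) (hQ : ∀ τ, Q τ → Frame c σ τ → Q' τ) : c.WP B Q' σ :=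
  h.and_frame.mono fun τ hτ => hQ τ hτ.1 hτ.2

theorem wp_seq : (Program.seq c d).WP B Q σ = c.WP B (d.WP B Q) σ := rfl

theorem wp_assign (x : ℕ) (y e : NatExp) :
    (assign x y e).WP B Q σ = Q (σ.setNat x (y.eval σ) (e.eval σ)) := rfl

theorem wp_setReal (x y : NatExp) (e : RealExp) :
    (Program.setReal x y e).WP B Q σ = Q (σ.setReal (x.eval σ) (y.eval σ) (e.eval σ)) := rfl

theorem wp_skip : Program.skip.WP B Q σ = Q σ := rfl

theorem wp_ite (t : Test) : (Program.ite t c d).WP B Q σ =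
    ((t.Holds σ → c.WP B Q σ) ∧ (¬ t.Holds σ → d.WP B Q σ)) := rfl

/-- Loops with an invariant `I` and a variant `μ`. -/
theorem wp_loop {t : Test} (I : Memory → Prop) (μ : Memory → ℕ) (h0 : I σ) (hμ : μ σ ≤ B)
    (hstep : ∀ ρ, I ρ → Frame c σ ρ → t.Holds ρ → c.WP B (fun τ => I τ ∧ μ τ < μ ρ) ρ)
    (hQ : ∀ ρ, I ρ → Frame c σ ρ → ¬ t.Holds ρ → Q ρ) : (Program.loop t c).WP B Q σ := by
  suffices ∀ N ρ, μ ρ = N → I ρ → Frame c σ ρ → ∃ k ≤ N, iterate t (WP B c) Q k ρ by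
    obtain ⟨k, hk, h⟩ := this (μ σ) σ rfl h0 (.refl _ _)
    exact ⟨k, hk.trans hμ, h⟩
  -- the number of runs is determined by the memory, so it need not be known in advance
  have det : ∀ (c : Program) (ρ : Memory) (P : Memory → ℕ → Prop) (Q : Memory → Prop),
      c.WP B (fun τ => Q τ ∧ ∃ k, P τ k) ρ → ∃ k, c.WP B (fun τ => Q τ ∧ P τ k) ρ := by
    intro c
    induction c with
    | skip => rintro ρ P Q ⟨h, k, hk⟩; exact ⟨k, h, hk⟩
    | setNat x y e => rintro ρ P Q ⟨h, k, hk⟩; exact ⟨k, h, hk⟩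
    | setReal x y e => rintro ρ P Q ⟨h, k, hk⟩; exact ⟨k, h, hk⟩
    | seq c d ihc ihd =>
      intro ρ P Q h
      obtain ⟨k, hk⟩ := ihc ρ (fun τ k => d.WP B (fun τ => Q τ ∧ P τ k) τ) (fun _ => True)
        (WP.mono h fun τ hτ => ⟨trivial, ihd τ P Q hτ⟩)
      exact ⟨k, WP.mono (c := c) hk fun τ hτ => hτ.2⟩
    | ite t c d ihc ihd =>
      intro ρ P Q h
      by_cases ht : t.Holds ρ
      · obtain ⟨k, hk⟩ := ihc ρ P Q (h.1 ht)
        exact ⟨k, fun _ => hk, fun hn => (hn ht).elim⟩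
      · obtain ⟨k, hk⟩ := ihd ρ P Q (h.2 ht)
        exact ⟨k, fun hn => (ht hn).elim, fun _ => hk⟩
    | loop t c ih =>
      intro ρ P Q h
      obtain ⟨N, hN, h⟩ := h
      suffices ∃ k, iterate t (WP B c) (fun τ => Q τ ∧ P τ k) N ρ by
        obtain ⟨k, hk⟩ := this
        exact ⟨k, N, hN, hk⟩
      clear hN
      induction N generalizing ρ with
      | zero => obtain ⟨h1, h2, k, hk⟩ := h; exact ⟨k, h1, h2, hk⟩
      | succ N ihN =>
        obtain ⟨k, hk⟩ := ih ρ (fun τ k => iterate t (WP B c) (fun τ => Q τ ∧ P τ k) N τ)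
          (fun _ => True) (WP.mono h.2 fun τ hτ => ⟨trivial, ihN τ hτ⟩)
        exact ⟨k, h.1, WP.mono hk fun τ hτ => hτ.2⟩
  intro N
  induction N using Nat.strong_induction_on with
  | _ N ih =>
  intro ρ hN hI hF
  by_cases ht : t.Holds ρ
  · have h1 := (hstep ρ hI hF ht).mono_frame (Q' := fun τ => True ∧ ∃ k, k < N ∧
        iterate t (WP B c) Q k τ) fun τ hτ hF' => by
      obtain ⟨k, hk, h⟩ := ih (μ τ) (hN ▸ hτ.2) τ rfl hτ.1 (hF.trans hF')
      exact ⟨trivial, k, by omega, h⟩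
    obtain ⟨k, hk⟩ := det _ _ _ _ h1
    -- The bound on `k` sits in a postcondition; the run of the body is produced only to read it
    -- off.
    have hkN : k < N := by
      obtain ⟨_, τ, _, _, h⟩ := hk.exec
      exact h.2.1
    exact ⟨k + 1, hkN, ht, hk.mono fun τ hτ => hτ.2.2⟩
  · exact ⟨0, Nat.zero_le _, ht, hQ ρ hI hF ht⟩

/-- Run `c` for all values of the variable `x` below the value of the variable `r`. -/
def forRange (x r : ℕ) (c : Program) : Program :=
  .seq (assign x (.const 0) (.const 0))
    (.loop (.natLt (.var x) (.var r)) (.seq c (assign x (.const 0) (.add (.var x) (.const 1)))))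

theorem wp_forRange {x r N : ℕ} (I : ℕ → Memory → Prop) (hN : σ.nat r 0 = N) (hNB : N ≤ B)
    (hcx : c.keeps x = true) (hcr : c.keeps r = true) (hxr : x ≠ r)
    (h0 : I 0 (σ.setNat x 0 0))
    (hstep : ∀ k < N, ∀ ρ, I k ρ → ρ.nat x 0 = k → Frame (forRange x r c) σ ρ →
      c.WP B (fun τ => I (k + 1) (τ.setNat x 0 (k + 1))) ρ)
    (hQ : ∀ ρ, I N ρ → ρ.nat x 0 = N → Frame (forRange x r c) σ ρ → Q ρ) :
    (forRange x r c).WP B Q σ := by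
  have hF0 : Frame (forRange x r c) σ (σ.setNat x 0 0) := by
    refine ⟨fun s hs => ?_, fun _ => rfl⟩
    simp [forRange, keeps, assign] at hs
    simp [Ne.symm hs.1]
  have hFF : ∀ ρ, Frame (.seq c (assign x (.const 0) (.add (.var x) (.const 1)))) (σ.setNat x 0 0) ρ
      → Frame (forRange x r c) σ ρ := fun ρ hρ => by
    refine hF0.trans (hρ.weaken ?_ ?_) <;> simp +contextual [forRange, keeps, keepsReal, assign]
  have hkr : (forRange x r c).keeps r = true := by
    simp [forRange, keeps, assign, hcr, hxr]
  rw [forRange, wp_seq, wp_assign]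
  refine wp_loop (fun ρ => I (ρ.nat x 0) ρ ∧ ρ.nat x 0 ≤ N) (fun ρ => N - ρ.nat x 0) ?_ ?_ ?_ ?_
  · simpa using h0
  · simp only [NatExp.eval, Memory.setNat_nat, if_true, Function.update_self]
    omega
  · intro ρ hI hF ht
    have hr := (hFF ρ hF).nat r hkr
    simp only [Test.Holds, NatExp.eval_var, hr, hN] at ht
    rw [wp_seq]
    refine (hstep _ ht ρ hI.1 rfl (hFF ρ hF)).mono_frame fun τ hτ hFτ => ?_
    rw [wp_assign]
    have hx := hFτ.nat x hcx
    simp only [NatExp.eval, NatExp.eval_var, hx, Memory.setNat_nat, if_true, Function.update_self]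
    exact ⟨⟨hτ, ht⟩, by omega⟩
  · intro ρ hI hF ht
    have hr := (hFF ρ hF).nat r hkr
    simp only [Test.Holds, NatExp.eval_var, hr, hN] at ht
    have : ρ.nat x 0 = N := by omega
    exact hQ ρ (this ▸ hI.1) this (hFF ρ hF)

/-- Search for a value of the variable `x` below the value of the variable `r` that satisfies the
test `t`, and store it in the variable `o`; if there is none, store the value of `r`. -/
def search (x r o : ℕ) (t : Test) : Program :=
  .seq (assign o (.const 0) (.var r))
    (forRange x r (.ite t (assign o (.const 0) (.var x)) .skip))

/-- The result `k` of a search for a number below `N` with property `T`. -/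
def IsFound (N : ℕ) (T : ℕ → Prop) (k : ℕ) : Prop :=
  k < N ∧ T k ∨ k = N ∧ ∀ l < N, ¬ T l

/-- The loop does not stop at a hit, so the last hit is stored. The test is evaluated in changing
memories, but the search writes only to its counter and its result. -/
theorem wp_search {x r o N : ℕ} {t : Test} (T : ℕ → Prop) (hN : σ.nat r 0 = N) (hNB : N ≤ B)
    (hxr : x ≠ r) (hox : o ≠ x) (hor : o ≠ r)
    (ht : ∀ ρ k, k < N → Frame (search x r o t) σ ρ → ρ.nat x 0 = k → (t.Holds ρ ↔ T k)) :
    (search x r o t).WP B (fun τ => IsFound N T (τ.nat o 0)) σ := by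
  rw [search, wp_seq, wp_assign]
  have hFF : ∀ ρ, Frame (forRange x r (.ite t (assign o (.const 0) (.var x)) .skip))
      (σ.setNat o 0 N) ρ → Frame (search x r o t) σ ρ := by
    intro ρ hρ
    refine ⟨fun s hs => ?_, fun _ => hρ.real rfl⟩
    have hs' := hs
    simp [search, forRange, keeps, assign] at hs
    rw [hρ.nat s (by simp [forRange, keeps, assign, hs])]
    simp [Ne.symm hs.1]
  simp only [NatExp.eval, NatExp.eval_var, hN]
  refine wp_forRange (fun k ρ => (ρ.nat o 0 < k ∧ T (ρ.nat o 0)) ∨ ρ.nat o 0 = N ∧ ∀ l < k, ¬ T l)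
    (N := N) ?_ hNB ?_ ?_ hxr ?_ ?_ ?_
  · simp [Ne.symm hor, hN]
  · simp [keeps, assign, hox]
  · simp [keeps, assign, hor]
  · simp [hox]
  · intro k hk ρ hI hx hF
    have hT := ht ρ k hk (hFF ρ hF) hx
    simp only [wp_ite, wp_assign, wp_skip, NatExp.eval, NatExp.eval_var, Memory.setNat_nat,
      if_neg hox, if_true, Function.update_self, hT, hx]
    constructor
    · intro h
      exact Or.inl ⟨by omega, h⟩
    · intro h
      have hnew : (∀ l < k, ¬ T l) → ∀ l < k + 1, ¬ T l := by
        intro h' l hl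
        rcases Nat.lt_succ_iff_lt_or_eq.1 hl with h1 | rfl
        · exact h' l h1
        · exact h
      rcases hI with h1 | h1
      · exact Or.inl ⟨by omega, h1.2⟩
      · exact Or.inr ⟨h1.1, hnew h1.2⟩
  · intro ρ hI _ _
    exact hI

end Program

end MatchFreeze

namespace MatchFreeze

/-!
### The program

Rows of natural number cells: `4` numbers of rounds until the agents are active again; `5` owners of
the goods (plus one) in the auction; `6` prices of the goods; `7` statuses of the agents in the
auction; `8` goods (plus one) received in the current round; `9` agents that freeze; `10` rounds
in which the agents froze most recently.
Variables: `11` number of the round; `12` number of rounds for which agents freeze; `13` an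
unallocated good; `14` an agent; `15`, `16` the cheapest good and its price; `17`, `18`, `19`
counters.
-/

namespace Program

open NatExp (var entry const)

/-- The value of the good `g` for the agent `i` is the lower one. -/
def isLow (i g : NatExp) : Test :=
  .realLt (.cell (.add i (const 1)) g) (.cell (const 0) (const 0))

/-- Find an agent who waits. -/
def findWaiting : Program := search 17 0 14 (.natEq (entry 7 (var 17)) (const 0))

/-- Find the cheapest good that is adjacent to an agent. -/
def findCheapest : Program :=
  .seq (assign 16 (const 0) (.add (var 1) (const 1)))
    (forRange 17 1
      (.ite (.and (.and (.natEq (entry 4 (var 14)) (const 0)) (.natEq (entry 3 (var 17)) (const 0)))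
          (.and (.not (isLow (var 14) (var 17))) (.natLt (entry 6 (var 17)) (var 16))))
        (.seq (assign 15 (const 0) (var 17)) (assign 16 (const 0) (entry 6 (var 17)))) .skip))

/-- An agent takes the cheapest adjacent good or gives up. -/
def bid : Program :=
  .seq findCheapest
    (.ite (.natLt (var 16) (.add (var 1) (const 1)))
      (.seq (.ite (.natLt (const 0) (entry 5 (var 15)))
          (assign 7 (.sub (entry 5 (var 15)) (const 1)) (const 0)) .skip)
        (.seq (assign 5 (var 15) (.add (var 14) (const 1)))
          (.seq (assign 6 (var 15) (.add (var 16) (const 1))) (assign 7 (var 14) (const 1)))))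
      (assign 7 (var 14) (const 2)))

/-- Compute a maximum matching. -/
def auction : Program :=
  .seq findWaiting (.loop (.natLt (var 14) (var 0)) (.seq bid findWaiting))

/-- Prepare the arrays for a round. -/
def initRound : Program :=
  .seq (forRange 18 0
      (.seq (.ite (.natLt (const 0) (entry 4 (var 18))) (assign 7 (var 18) (const 2))
          (assign 7 (var 18) (const 0)))
        (.seq (assign 8 (var 18) (const 0)) (assign 9 (var 18) (const 0)))))
    (forRange 18 1 (.seq (assign 5 (var 18) (const 0)) (assign 6 (var 18) (const 0))))

/-- Give the good `g` to the agent `i`. -/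
def give (i g : NatExp) : Program :=
  .seq (assign 2 g i) (.seq (assign 3 g (var 11)) (assign 8 i (.add g (const 1))))

/-- Give the matched goods to the agents. -/
def giveMatched : Program :=
  forRange 18 1 (.ite (.natLt (const 0) (entry 5 (var 18)))
    (give (.sub (entry 5 (var 18)) (const 1)) (var 18)) .skip)

/-- Find an unallocated good. -/
def findFree : Program := search 17 1 13 (.natEq (entry 3 (var 17)) (const 0))

/-- Give an unallocated good, if there is one, to an agent. -/
def giveFree : Program :=
  .seq findFree (.ite (.natLt (var 13) (var 1)) (give (var 18) (var 13)) .skip)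

/-- Serve the unmatched active agents in the order of the list. -/
def serve : Program :=
  forRange 19 11 (forRange 18 0
    (.ite (.and (.natEq (entry 4 (var 18)) (const 0)) (.and (.natEq (entry 7 (var 18)) (const 2))
        (.natEq (entry 10 (var 18)) (var 19))))
      giveFree .skip))

/-- The agent `i`, not yet known to freeze, has to freeze because of the agent `j`. -/
def mustFreeze (i j : NatExp) : Test :=
  .and (.and (.natEq (entry 9 i) (const 0)) (.natLt (const 0) (entry 8 i)))
    (.and (.not (isLow j (.sub (entry 8 i) (const 1))))
      (.or (.natLt (const 0) (entry 9 j))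
        (.and (.natLt (const 0) (entry 8 j)) (isLow j (.sub (entry 8 j) (const 1))))))

/-- Find an agent that has to freeze. -/
def findFreezing : Program :=
  .seq (assign 14 (const 0) (var 0))
    (forRange 18 0 (forRange 17 0
      (.ite (mustFreeze (var 18) (var 17)) (assign 14 (const 0) (var 18)) .skip)))

/-- Compute the agents that freeze. -/
def freeze : Program :=
  .seq findFreezing
    (.loop (.natLt (var 14) (var 0)) (.seq (assign 9 (var 14) (const 1)) findFreezing))

/-- Update the remaining numbers of frozen rounds and the list. -/
def finishRound : Program :=
  forRange 18 0 (.ite (.natLt (const 0) (entry 9 (var 18)))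
    (.seq (assign 4 (var 18) (var 12)) (assign 10 (var 18) (var 11)))
    (assign 4 (var 18) (.sub (entry 4 (var 18)) (const 1))))

/-- One round of the algorithm. -/
def round : Program :=
  .seq (assign 11 (const 0) (.add (var 11) (const 1)))
    (.seq initRound (.seq auction (.seq giveMatched (.seq serve (.seq freeze finishRound)))))

/-- Compute the number of rounds for which agents freeze, at most `m`. -/
def computeFreezeLength : Program :=
  .seq (.setReal (const 0) (const 2)
      (.add (.cell (const 0) (const 1)) (.cell (const 0) (const 1))))
    (.loop (.and (.not (.realLt (.cell (const 0) (const 0)) (.cell (const 0) (const 2))))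
        (.natLt (var 12) (var 1)))
      (.seq (.setReal (const 0) (const 2)
          (.add (.cell (const 0) (const 2)) (.cell (const 0) (const 1))))
        (assign 12 (const 0) (.add (var 12) (const 1)))))

/-- The program for Match&Freeze. -/
def matchFreeze : Program :=
  .seq computeFreezeLength
    (.seq findFree (.loop (.natLt (var 13) (var 1)) (.seq round findFree)))

end Program

/-! ### Correctness of the matching phase -/

/-- The memory contains the input. -/
structure HasInput {n m : ℕ} (a b : ℝ) (v : Fin n → Fin m → ℝ) (σ : Memory) : Prop where
  cell_n : σ.nat 0 0 = n
  cell_m : σ.nat 1 0 = m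
  cell_a : σ.real 0 0 = a
  cell_b : σ.real 0 1 = b
  cell_v : ∀ (i : Fin n) (g : Fin m), σ.real (i + 1) g = v i g

theorem HasInput.congr {n m : ℕ} {a b : ℝ} {v : Fin n → Fin m → ℝ} {σ τ : Memory}
    (h : HasInput a b v σ) (h0 : τ.nat 0 = σ.nat 0) (h1 : τ.nat 1 = σ.nat 1)
    (hr : τ.real = σ.real) : HasInput a b v τ :=
  ⟨by rw [h0]; exact h.cell_n, by rw [h1]; exact h.cell_m, by rw [hr]; exact h.cell_a, by rw [hr]; exact h.cell_b,
    by rw [hr]; exact h.cell_v⟩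

theorem HasInput.frame {n m : ℕ} {a b : ℝ} {v : Fin n → Fin m → ℝ} {σ τ : Memory} {c : Program}
    (h : HasInput a b v σ) (hF : Program.Frame c σ τ) (h0 : c.keeps 0 = true)
    (h1 : c.keeps 1 = true) (hr : c.keepsReal = true) : HasInput a b v τ :=
  h.congr (hF.nat 0 h0) (hF.nat 1 h1) (hF.real hr)

/-- Replaces equality of reals by a single comparison. -/
theorem IsTwoValue.not_lt_iff {n m : ℕ} {a b : ℝ} {v : Fin n → Fin m → ℝ}
    (hv : IsTwoValue a b v) (i : Fin n) (g : Fin m) : ¬ v i g < a ↔ v i g = a := by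
  have := hv.le i g
  exact ⟨fun h => le_antisymm this (not_lt.1 h), fun h => by simp [h]⟩

theorem IsTwoValue.lt_iff {n m : ℕ} {a b : ℝ} {v : Fin n → Fin m → ℝ}
    (hv : IsTwoValue a b v) (i : Fin n) (g : Fin m) : v i g < a ↔ v i g = b := by
  have := hv.lt
  rcases hv.mem i g with h | h <;> rw [h]
  · simp [this.ne']
  · simp [this]

namespace Program

open NatExp (var entry const)

variable {n m B : ℕ} {a b : ℝ} {v : Fin n → Fin m → ℝ} {σ : Memory}

theorem holds_isLow (hI : HasInput a b v σ) {i g : NatExp} (hi : i.eval σ < n)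
    (hg : g.eval σ < m) :
    (isLow i g).Holds σ ↔ v ⟨i.eval σ, hi⟩ ⟨g.eval σ, hg⟩ < a := by
  have := hI.cell_v ⟨i.eval σ, hi⟩ ⟨g.eval σ, hg⟩
  simp only [isLow, Test.Holds, RealExp.eval, NatExp.eval, hI.cell_a, ← this]

section Auction

variable {L : Finset (Fin n)} {R : Finset (Fin m)}

/-- The cap `m + 1` is the initial value of the minimum, so a result at the cap signals that the
agent has no adjacent good below it and must give up. -/
theorem wp_findCheapest (hv : IsTwoValue a b v) (hI : HasInput a b v σ)
    (hL : ∀ i : Fin n, i ∈ L ↔ σ.nat 4 i = 0) (hR : ∀ g : Fin m, g ∈ R ↔ σ.nat 3 g = 0)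
    (hm : m ≤ B) {i : ℕ} (hi : i < n) (h14 : σ.nat 14 0 = i) :
    findCheapest.WP B (fun τ =>
      (τ.nat 16 0 < m + 1 → natAdj a v L R i (τ.nat 15 0) ∧ σ.nat 6 (τ.nat 15 0) = τ.nat 16 0) ∧
      τ.nat 16 0 ≤ m + 1 ∧ ∀ g, natAdj a v L R i g → τ.nat 16 0 ≤ σ.nat 6 g) σ := by
  rw [findCheapest, wp_seq, wp_assign]
  refine wp_forRange (N := m) (fun k τ =>
      (τ.nat 16 0 < m + 1 → natAdj a v L R i (τ.nat 15 0) ∧ σ.nat 6 (τ.nat 15 0) = τ.nat 16 0) ∧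
      τ.nat 16 0 ≤ m + 1 ∧ ∀ g < k, natAdj a v L R i g → τ.nat 16 0 ≤ σ.nat 6 g)
    ?_ hm rfl rfl (by decide) ?_ ?_ ?_
  · simpa using hI.cell_m
  · simp [hI.cell_m]
  · intro k hk ρ hρ h17 hF
    have h3 : ρ.nat 3 = σ.nat 3 := by simpa using hF.nat 3 rfl
    have h4 : ρ.nat 4 = σ.nat 4 := by simpa using hF.nat 4 rfl
    have h6 : ρ.nat 6 = σ.nat 6 := by simpa using hF.nat 6 rfl
    have h14' : ρ.nat 14 = σ.nat 14 := by simpa using hF.nat 14 rfl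
    have hIρ : HasInput a b v ρ :=
      hI.congr (by simpa using hF.nat 0 rfl) (by simpa using hF.nat 1 rfl)
        (by simpa using hF.real rfl)
    have hlow := holds_isLow hIρ (i := var 14) (g := var 17) (by simpa [h14', h14] using hi)
      (by simpa [h17] using hk)
    simp only [NatExp.eval_var, h14', h14, h17] at hlow
    have hadj : natAdj a v L R i k ↔ σ.nat 4 i = 0 ∧ σ.nat 3 k = 0 ∧ v ⟨i, hi⟩ ⟨k, hk⟩ = a := by
      have := natAdj_coe (a := a) (v := v) (L := L) (R := R) (i := ⟨i, hi⟩) (g := ⟨k, hk⟩)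
      rw [hL, hR] at this
      exact this
    have hall : ∀ p : ℕ, p ≤ σ.nat 6 k ∨ ¬ natAdj a v L R i k →
        (∀ g < k, natAdj a v L R i g → p ≤ σ.nat 6 g) →
        ∀ g < k + 1, natAdj a v L R i g → p ≤ σ.nat 6 g := by
      intro p hp h g hg hgadj
      rcases Nat.lt_succ_iff_lt_or_eq.1 hg with h1 | rfl
      · exact h g h1 hgadj
      · exact hp.resolve_right (not_not.2 hgadj)
    simp only [wp_ite, wp_seq, wp_assign, wp_skip, Test.Holds, Test.holds_natEq, hlow,
      hv.not_lt_iff, NatExp.eval, NatExp.eval_var, NatExp.eval_entry, h3, h4, h6, h14', h14, h17]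
    obtain ⟨hρ1, hρ2, hρ3⟩ := hρ
    constructor
    · rintro ⟨⟨c1, c2⟩, c3, c4⟩
      have hk' := hadj.2 ⟨c1, c2, c3⟩
      simp [h17, h6, -Order.lt_add_one_iff]
      refine ⟨fun _ => hk', by omega, hall _ (Or.inl le_rfl) fun g hg hgadj => ?_⟩
      exact c4.le.trans (hρ3 g hg hgadj)
    · intro hn
      simp [-Order.lt_add_one_iff]
      refine ⟨hρ1, hρ2, hall _ ?_ hρ3⟩
      rw [hadj]
      by_contra! hc
      exact hn ⟨⟨hc.2.1, hc.2.2.1⟩, hc.2.2.2, hc.1⟩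
  · intro ρ hρ _ _
    exact ⟨hρ.1, hρ.2.1, fun g hg => hρ.2.2 g hg.2.1 hg⟩

theorem wp_findWaiting (hI : HasInput a b v σ) (hn : n ≤ B) :
    findWaiting.WP B (fun τ => IsFound n (fun i => σ.nat 7 i = 0) (τ.nat 14 0)) σ := by
  refine wp_search _ hI.cell_n hn (by decide) (by decide) (by decide) fun ρ k hk hF hx => ?_
  simp [hx, hF.nat 7 rfl]

/-- The writes are those of `Auction.take` or `Auction.give_up`, so the invariant and the decrease
of the potential carry over. -/
theorem wp_bid (hv : IsTwoValue a b v) (hI : HasInput a b v σ)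
    (hL : ∀ i : Fin n, i ∈ L ↔ σ.nat 4 i = 0) (hR : ∀ g : Fin m, g ∈ R ↔ σ.nat 3 g = 0)
    (hm : m ≤ B) (hi : σ.nat 14 0 < n) (h0 : σ.nat 7 (σ.nat 14 0) = 0)
    (H : Auction n m (natAdj a v L R) (σ.nat 5) (σ.nat 6) (σ.nat 7)) :
    bid.WP B (fun τ => Auction n m (natAdj a v L R) (τ.nat 5) (τ.nat 6) (τ.nat 7) ∧
      Auction.potential n m (τ.nat 6) (τ.nat 7) < Auction.potential n m (σ.nat 6) (σ.nat 7)) σ := by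
  rw [bid, wp_seq]
  refine (wp_findCheapest hv hI hL hR hm hi rfl).mono_frame fun ρ hρ hF => ?_
  obtain ⟨h1, h2, h3⟩ := hρ
  have e1 : ρ.nat 1 = σ.nat 1 := hF.nat 1 rfl
  have e5 : ρ.nat 5 = σ.nat 5 := hF.nat 5 rfl
  have e6 : ρ.nat 6 = σ.nat 6 := hF.nat 6 rfl
  have e7 : ρ.nat 7 = σ.nat 7 := hF.nat 7 rfl
  have e14 : ρ.nat 14 = σ.nat 14 := hF.nat 14 rfl
  simp only [wp_ite, wp_seq, wp_assign, wp_skip, Test.Holds, NatExp.eval, NatExp.eval_var,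
    NatExp.eval_entry, e1, hI.cell_m]
  constructor
  · intro hlt
    obtain ⟨h4, h5⟩ := h1 hlt
    have := H.take h0 h4 (by omega) (fun g hg => h5 ▸ h3 g hg)
    unfold Auction.dispossess at this
    rw [h5] at this
    constructor
    · intro hpos
      rw [e5] at hpos
      simpa [e5, e6, e7, e14, hpos] using this
    · intro hpos
      rw [e5] at hpos
      simpa [e5, e6, e7, e14, hpos] using this
  · intro hge
    have := H.give_up hi h0 fun g hg => by have := h3 g hg; omega
    simpa [e5, e6, e7, e14] using this

/-- The potential is the loop variant; its bound is the reason why `B` has to be quadratic in `m`.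
-/
theorem wp_auction (hv : IsTwoValue a b v) (hI : HasInput a b v σ)
    (hL : ∀ i : Fin n, i ∈ L ↔ σ.nat 4 i = 0) (hR : ∀ g : Fin m, g ∈ R ↔ σ.nat 3 g = 0)
    (hn : n ≤ B) (hm : m ≤ B) (hB : m * (m + 1) + n ≤ B)
    (H : Auction n m (natAdj a v L R) (σ.nat 5) (σ.nat 6) (σ.nat 7)) :
    auction.WP B (fun τ => Auction n m (natAdj a v L R) (τ.nat 5) (τ.nat 6) (τ.nat 7) ∧
      ∀ i < n, τ.nat 7 i ≠ 0) σ := by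
  rw [auction, wp_seq]
  refine (wp_findWaiting hI hn).mono_frame fun ρ hρ hF => ?_
  refine wp_loop (fun τ => Auction n m (natAdj a v L R) (τ.nat 5) (τ.nat 6) (τ.nat 7) ∧
      IsFound n (fun i => τ.nat 7 i = 0) (τ.nat 14 0))
    (fun τ => Auction.potential n m (τ.nat 6) (τ.nat 7)) ?_
    ((Auction.potential_le _ _ _ _).trans hB) ?_ ?_
  · rw [hF.nat 5 rfl, hF.nat 6 rfl, hF.nat 7 rfl]
    exact ⟨H, hρ⟩
  · rintro τ ⟨hA, hf⟩ hF' ht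
    have hIτ : HasInput a b v τ := (hI.frame hF rfl rfl rfl).frame hF' rfl rfl rfl
    have e3 : τ.nat 3 = σ.nat 3 := (hF'.nat 3 rfl).trans (hF.nat 3 rfl)
    have e4 : τ.nat 4 = σ.nat 4 := (hF'.nat 4 rfl).trans (hF.nat 4 rfl)
    simp only [Test.Holds, NatExp.eval_var, hIτ.cell_n] at ht
    have h0 : τ.nat 7 (τ.nat 14 0) = 0 := by
      rcases hf with h | h
      · exact h.2
      · omega
    rw [wp_seq]
    refine (wp_bid hv hIτ (e4 ▸ hL) (e3 ▸ hR) hm ht h0 hA).mono_frame fun τ' hτ' hF'' => ?_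
    refine (wp_findWaiting (hIτ.frame hF'' rfl rfl rfl) hn).mono_frame fun τ'' hf'' hF3 => ?_
    rw [hF3.nat 5 rfl, hF3.nat 6 rfl, hF3.nat 7 rfl]
    exact ⟨⟨hτ'.1, hf''⟩, hτ'.2⟩
  · rintro τ ⟨hA, hf⟩ hF' ht
    have hIτ : HasInput a b v τ := (hI.frame hF rfl rfl rfl).frame hF' rfl rfl rfl
    simp only [Test.Holds, NatExp.eval_var, hIτ.cell_n] at ht
    refine ⟨hA, ?_⟩
    rcases hf with h | h
    · omega
    · exact h.2

end Auction

end Program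

end MatchFreeze

/-! ### Handing out goods -/

namespace MatchFreeze

variable {n m : ℕ} {a b : ℝ} {v : Fin n → Fin m → ℝ}

/-- The rows `r2`, `r3` (output) and `r8` record that the pairs `E` have been handed out in
round `t`, when the output was given by the rows `o2` and `o3` before the round. -/
structure Records (E : Finset (Fin n × Fin m)) (t : ℕ) (o2 o3 r2 r3 r8 : ℕ → ℕ) : Prop where
  mem_iff : ∀ i g, (i, g) ∈ E ↔ r8 i = g + 1
  le : ∀ i : Fin n, r8 i ≤ m
  new : ∀ i g, (i, g) ∈ E → r2 g = i ∧ r3 g = t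
  old : ∀ g : Fin m, (∀ i, (i, g) ∉ E) → r2 g = o2 g ∧ r3 g = o3 g

namespace Records

variable {E : Finset (Fin n × Fin m)} {t : ℕ} {o2 o3 r2 r3 r8 : ℕ → ℕ}

theorem empty (h : ∀ i : Fin n, r8 i = 0) :
    Records (∅ : Finset (Fin n × Fin m)) t o2 o3 o2 o3 r8 where
  mem_iff i g := by simp [h i]
  le i := by simp [h i]
  new i g h := by simp at h
  old g _ := ⟨rfl, rfl⟩

theorem insert (h : Records E t o2 o3 r2 r3 r8) {i : Fin n} {g : Fin m}
    (hi : ∀ h, (i, h) ∉ E) (hg : ∀ j, (j, g) ∉ E) :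
    Records (insert (i, g) E) t o2 o3 (Function.update r2 g i) (Function.update r3 g t)
      (Function.update r8 i (g + 1)) where
  mem_iff j k := by
    rw [Finset.mem_insert, Prod.mk.injEq]
    by_cases hj : j = i
    · subst hj
      simp only [hi, or_false, true_and, Function.update_self, Nat.add_right_cancel_iff]
      rw [Fin.ext_iff]
      exact eq_comm
    · rw [Function.update_of_ne (fun hc => hj (Fin.ext hc)), ← h.mem_iff]
      simp [hj]
  le j := by
    by_cases hj : j = i
    · subst hj
      simp
    · rw [Function.update_of_ne (fun hc => hj (Fin.ext hc))]
      exact h.le j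
  new j k hjk := by
    rw [Finset.mem_insert, Prod.mk.injEq] at hjk
    rcases hjk with ⟨rfl, rfl⟩ | hjk
    · simp
    · have hk : k ≠ g := by
        rintro rfl
        exact hg j hjk
      have hk' : (k : ℕ) ≠ g := fun hc => hk (Fin.ext hc)
      rw [Function.update_of_ne hk', Function.update_of_ne hk']
      exact h.new j k hjk
  old k hk := by
    have hk' : (k : ℕ) ≠ g := fun hc => hk i (by rw [Fin.ext hc]; exact Finset.mem_insert_self _ _)
    rw [Function.update_of_ne hk', Function.update_of_ne hk']
    exact h.old k fun j hj => hk j (Finset.mem_insert_of_mem hj)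

theorem ne_zero_iff (h : Records E t o2 o3 r2 r3 r8) (i : Fin n) :
    0 < r8 i ↔ ∃ g, (i, g) ∈ E := by
  constructor
  · intro hp
    have := h.le i
    exact ⟨⟨r8 i - 1, by omega⟩, by rw [h.mem_iff]; simp; omega⟩
  · rintro ⟨g, hg⟩
    rw [h.mem_iff] at hg
    omega

/-- The goods without a round are those that have not been handed out. -/
theorem free_iff (h : Records E t o2 o3 r2 r3 r8) (ht : 0 < t) (g : Fin m) :
    r3 g = 0 ↔ o3 g = 0 ∧ ∀ i, (i, g) ∉ E := by
  by_cases hg : ∃ i, (i, g) ∈ E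
  · obtain ⟨i, hi⟩ := hg
    have := (h.new i g hi).2
    constructor
    · omega
    · exact fun hc => (hc.2 i hi).elim
  · push Not at hg
    rw [(h.old g hg).2]
    simp [hg]

end Records

/-- The list of agents in which the agents are sorted by the keys, and agents with equal keys are in
their natural order; all keys are below `t`. -/
def sortedList (n : ℕ) (key : ℕ → ℕ) (t : ℕ) : List (Fin n) :=
  (List.range t).flatMap fun k => (List.finRange n).filter fun i : Fin n => key i = k

theorem mem_sortedList {key : ℕ → ℕ} {t : ℕ} {i : Fin n} : i ∈ sortedList n key t ↔ key i < t := by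
  simp [sortedList]

theorem sortedList_succ (n : ℕ) (key : ℕ → ℕ) (t : ℕ) : sortedList n key (t + 1) =
    sortedList n key t ++ (List.finRange n).filter (fun i : Fin n => key i = t) := by
  simp [sortedList, List.range_succ]

section Serve

variable {l : List (Fin n)} {R : Finset (Fin m)} {D : Finset (Fin n × Fin m)}

/-- `Serve` consumes its list from the front, while the program extends the list of served agents at
the back. -/
theorem Serve.concat (h : Serve l R D) (i : Fin n) : ∀ g ∈ R, (∀ j, (j, g) ∉ D) →
    Serve (l ++ [i]) R (insert (i, g) D) := by
  induction h with
  | done R => exact fun g hg _ => .give i [] R g ∅ hg (.done _)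
  | noGoods l => simp
  | give j l R h D hh hD ih =>
    intro g hg hno
    have hgh : g ≠ h := by
      rintro rfl
      exact hno j (Finset.mem_insert_self _ _)
    rw [Finset.insert_comm]
    exact .give j _ R h _ hh (ih g (by simp [hgh, hg]) fun k hk =>
      hno k (Finset.mem_insert_of_mem hk))

theorem Serve.concat_of_full (h : Serve l R D) (i : Fin n) : (∀ g ∈ R, ∃ j, (j, g) ∈ D) →
    Serve (l ++ [i]) R D := by
  induction h with
  | done R =>
    intro hR
    have : R = ∅ := Finset.eq_empty_iff_forall_notMem.2 fun g hg => by simpa using hR g hg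
    subst this
    exact .noGoods _
  | noGoods l => exact fun _ => .noGoods _
  | give j l R h D hh hD ih =>
    intro hR
    refine .give j _ R h _ hh (ih fun g hg => ?_)
    rw [Finset.mem_erase] at hg
    obtain ⟨k, hk⟩ := hR g hg.2
    rw [Finset.mem_insert, Prod.mk.injEq] at hk
    exact ⟨k, hk.resolve_left fun hc => hg.1 hc.2⟩

end Serve

namespace Program

open NatExp (var entry const)

variable {B : ℕ} {σ : Memory}

/-- Frozen agents enter the auction as having given up, which is consistent because they have no
edges. -/
theorem wp_initRound (hI : HasInput a b v σ) (hn : n ≤ B) (hm : m ≤ B) :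
    initRound.WP B (fun τ =>
      (∀ i < n, τ.nat 7 i = (if σ.nat 4 i = 0 then 0 else 2) ∧ τ.nat 8 i = 0 ∧ τ.nat 9 i = 0) ∧
      ∀ g < m, τ.nat 5 g = 0 ∧ τ.nat 6 g = 0) σ := by
  rw [initRound, wp_seq]
  refine wp_forRange (N := n) (fun k τ => ∀ i < k, τ.nat 7 i = (if σ.nat 4 i = 0 then 0 else 2) ∧
    τ.nat 8 i = 0 ∧ τ.nat 9 i = 0) hI.cell_n hn rfl rfl (by decide) (by simp) ?_ ?_
  · intro k hk ρ hρ h18 hF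
    have e4 : ρ.nat 4 = σ.nat 4 := hF.nat 4 rfl
    simp only [wp_ite, wp_seq, wp_assign, Test.Holds, NatExp.eval, NatExp.eval_var,
      NatExp.eval_entry, e4, h18]
    constructor <;> intro h4 i hi <;> by_cases hik : i = k
    · subst hik
      simp [h18]
      omega
    · have := hρ i (by omega)
      simp [hik, h18, this]
    · subst hik
      simp [h18]
      omega
    · have := hρ i (by omega)
      simp [hik, h18, this]
  · intro ρ hρ _ hF
    have hIρ := hI.frame hF rfl rfl rfl
    have hw := wp_forRange (B := B) (x := 18) (r := 1) (σ := ρ) (N := m)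
      (c := .seq (assign 5 (var 18) (const 0)) (assign 6 (var 18) (const 0)))
      (Q := fun τ => ∀ g < m, τ.nat 5 g = 0 ∧ τ.nat 6 g = 0)
      (fun k τ => ∀ g < k, τ.nat 5 g = 0 ∧ τ.nat 6 g = 0) hIρ.cell_m hm rfl rfl (by decide)
      (by simp) ?_ ?_
    · refine hw.mono_frame fun τ hτ hF' => ⟨?_, hτ⟩
      rwa [hF'.nat 7 rfl, hF'.nat 8 rfl, hF'.nat 9 rfl]
    · intro k hk ρ' hρ' h18 _
      simp only [wp_seq, wp_assign, NatExp.eval, NatExp.eval_var, h18]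
      intro g hg
      by_cases hgk : g = k
      · simp [hgk, h18]
      · have := hρ' g (by omega)
        simp [hgk, h18, this]
    · exact fun ρ' h _ _ => h

theorem wp_giveMatched {t : ℕ} (hI : HasInput a b v σ) (hm : m ≤ B) (ht : σ.nat 11 0 = t)
    (h8 : ∀ i < n, σ.nat 8 i = 0) {L : Finset (Fin n)} {R : Finset (Fin m)} {price st : ℕ → ℕ}
    (H : Auction n m (natAdj a v L R) (σ.nat 5) price st) :
    giveMatched.WP B (fun τ => Records (heldPairs n m (σ.nat 5)) t (σ.nat 2) (σ.nat 3) (τ.nat 2)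
      (τ.nat 3) (τ.nat 8)) σ := by
  refine wp_forRange (N := m) (fun k τ =>
      Records ((heldPairs n m (σ.nat 5)).filter fun e => e.2 < k) t (σ.nat 2) (σ.nat 3)
        (τ.nat 2) (τ.nat 3) (τ.nat 8)) hI.cell_m hm rfl rfl (by decide) ?_ ?_ ?_
  · simpa using Records.empty fun i => h8 i i.2
  · intro k hk ρ hρ h18 hF
    have e5 : ρ.nat 5 = σ.nat 5 := hF.nat 5 rfl
    have e11 : ρ.nat 11 = σ.nat 11 := hF.nat 11 rfl
    simp only [wp_ite, give, wp_seq, wp_assign, wp_skip, Test.Holds, NatExp.eval, NatExp.eval_var,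
      NatExp.eval_entry]
    constructor
    · intro hpos
      rw [e5, h18] at hpos
      obtain ⟨i, hi⟩ := Nat.exists_eq_succ_of_ne_zero hpos.ne'
      have hin := (H.lt i k (H.adj_of_own i k hk hi)).1
      have hfilter : ((heldPairs n m (σ.nat 5)).filter fun e => e.2 < k + 1) =
          insert (⟨i, hin⟩, ⟨k, hk⟩) ((heldPairs n m (σ.nat 5)).filter fun e => e.2 < k) := by
        ext ⟨j, g⟩
        simp only [Finset.mem_filter, Finset.mem_insert, mem_heldPairs, Prod.mk.injEq,
          Fin.ext_iff]
        constructor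
        · rintro ⟨h1, h2⟩
          by_cases hgk : (g : ℕ) = k
          · rw [hgk, hi] at h1
            exact Or.inl ⟨by omega, hgk⟩
          · exact Or.inr ⟨h1, by omega⟩
        · rintro (⟨h1, h2⟩ | h1)
          · rw [h1, h2]
            exact ⟨hi, by omega⟩
          · exact ⟨h1.1, by omega⟩
      have := hρ.insert (i := ⟨i, hin⟩) (g := ⟨k, hk⟩) (by
        simp only [Finset.mem_filter, mem_heldPairs, not_and]
        intro h hh hlt
        have := H.inj i k h hk h.2 hi hh
        omega) (by simp)
      rw [← hfilter] at this
      simpa [h18, e5, e11, hi, ht] using this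
    · intro hpos
      rw [e5, h18] at hpos
      have hfilter : ((heldPairs n m (σ.nat 5)).filter fun e => e.2 < k + 1) =
          ((heldPairs n m (σ.nat 5)).filter fun e => e.2 < k) := by
        ext ⟨j, g⟩
        simp only [Finset.mem_filter, mem_heldPairs]
        constructor
        · rintro ⟨h1, h2⟩
          refine ⟨h1, ?_⟩
          by_contra hc
          have : (g : ℕ) = k := by omega
          rw [this] at h1
          omega
        · exact fun h1 => ⟨h1.1, by omega⟩
      rw [hfilter]
      simpa using hρ
  · intro ρ hρ _ _
    have hfilter : ((heldPairs n m (σ.nat 5)).filter fun e => e.2 < m) =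
        heldPairs n m (σ.nat 5) := Finset.filter_true_of_mem fun e _ => e.2.2
    rwa [hfilter] at hρ

theorem wp_findFree (hI : HasInput a b v σ) (hm : m ≤ B) :
    findFree.WP B (fun τ => IsFound m (fun g => σ.nat 3 g = 0) (τ.nat 13 0)) σ := by
  refine wp_search _ hI.cell_m hm (by decide) (by decide) (by decide) fun ρ k hk hF hx => ?_
  simp [hx, hF.nat 3 rfl]

/-- The agent in the variable `18` is served. -/
theorem wp_giveFree {t : ℕ} {o2 o3 : ℕ → ℕ} {M D : Finset (Fin n × Fin m)} {R : Finset (Fin m)}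
    {l : List (Fin n)} (hI : HasInput a b v σ) (hm : m ≤ B) (ht : σ.nat 11 0 = t) (ht0 : 0 < t)
    (hR : ∀ g, g ∈ R ↔ o3 g = 0 ∧ ∀ i, (i, g) ∉ M) {i : Fin n} (hi : σ.nat 18 0 = i)
    (hiM : ∀ g, (i, g) ∉ M) (hil : i ∉ l) (hD : Serve l R D)
    (hrec : Records (M ∪ D) t o2 o3 (σ.nat 2) (σ.nat 3) (σ.nat 8)) :
    giveFree.WP B (fun τ => ∃ D, Serve (l ++ [i]) R D ∧
      Records (M ∪ D) t o2 o3 (τ.nat 2) (τ.nat 3) (τ.nat 8)) σ := by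
  rw [giveFree, wp_seq]
  refine (wp_findFree hI hm).mono_frame fun ρ hρ hF => ?_
  have hIρ := hI.frame hF rfl rfl rfl
  have e2 : ρ.nat 2 = σ.nat 2 := hF.nat 2 rfl
  have e3 : ρ.nat 3 = σ.nat 3 := hF.nat 3 rfl
  have e8 : ρ.nat 8 = σ.nat 8 := hF.nat 8 rfl
  have e11 : ρ.nat 11 = σ.nat 11 := hF.nat 11 rfl
  have e18 : ρ.nat 18 = σ.nat 18 := hF.nat 18 rfl
  have hfree : ∀ g : Fin m, σ.nat 3 g = 0 ↔ g ∈ R ∧ ∀ j, (j, g) ∉ D := by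
    intro g
    rw [hrec.free_iff ht0, hR]
    simp only [Finset.mem_union, not_or]
    grind
  simp only [wp_ite, give, wp_seq, wp_assign, wp_skip, Test.Holds, NatExp.eval, NatExp.eval_var,
 hIρ.cell_m]
  constructor
  · intro hlt
    have h0 := (hρ.resolve_right fun h => by omega).2
    set g : Fin m := ⟨ρ.nat 13 0, hlt⟩ with hg
    obtain ⟨hgR, hgD⟩ := (hfree g).1 h0
    refine ⟨_, hD.concat i g hgR hgD, ?_⟩
    have hiD : ∀ h, (i, h) ∉ D := fun h hh => hil (hD.mem i h hh).1
    have := hrec.insert (i := i) (g := g) (by simp [hiM, hiD]) (by simp [hgD, ((hR g).1 hgR).2])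
    rw [Finset.union_insert]
    simpa [e2, e3, e8, e11, e18, hi, ht, hg] using this
  · intro hge
    have h0 := (hρ.resolve_left fun h => hge h.1).2
    refine ⟨D, hD.concat_of_full i fun g hg => ?_, by rwa [e2, e3, e8]⟩
    by_contra hc
    push Not at hc
    exact h0 g g.2 ((hfree g).2 ⟨hg, hc⟩)

theorem filter_take_succ {k : ℕ} (hk : k < n) (p : Fin n → Bool) :
    ((List.finRange n).take (k + 1)).filter p =
      ((List.finRange n).take k).filter p ++ if p ⟨k, hk⟩ then [⟨k, hk⟩] else [] := by
  rw [List.take_succ_eq_append_getElem (by simpa using hk), List.filter_append]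
  congr 1
  simp [List.filter_singleton]

/-- The outer loop runs through the keys and the inner one through the agents in natural order,
which is the order of `sortedList`. No list is ever stored. -/
theorem wp_serve {t : ℕ} {o2 o3 : ℕ → ℕ} {M : Finset (Fin n × Fin m)} {R : Finset (Fin m)}
    {c : Fin n → Bool} (hI : HasInput a b v σ) (hn : n ≤ B) (hm : m ≤ B) (htB : t ≤ B)
    (ht : σ.nat 11 0 = t) (ht0 : 0 < t) (hR : ∀ g, g ∈ R ↔ o3 g = 0 ∧ ∀ i, (i, g) ∉ M)
    (hc : ∀ i : Fin n, c i = true ↔ σ.nat 4 i = 0 ∧ σ.nat 7 i = 2)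
    (hcM : ∀ i, c i = true → ∀ g, (i, g) ∉ M)
    (hrec : Records M t o2 o3 (σ.nat 2) (σ.nat 3) (σ.nat 8)) :
    serve.WP B (fun τ => ∃ D, Serve ((sortedList n (σ.nat 10) t).filter c) R D ∧
      Records (M ∪ D) t o2 o3 (τ.nat 2) (τ.nat 3) (τ.nat 8)) σ := by
  refine wp_forRange (N := t) (fun k τ => ∃ D, Serve ((sortedList n (σ.nat 10) k).filter c) R D ∧
      Records (M ∪ D) t o2 o3 (τ.nat 2) (τ.nat 3) (τ.nat 8)) ht htB rfl rfl (by decide) ?_ ?_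
      (fun _ h _ _ => h)
  · exact ⟨∅, by simpa [sortedList] using Serve.done R, by simpa using hrec⟩
  · intro k hk ρ hρ h19 hF
    have hIρ := hI.frame hF rfl rfl rfl
    refine wp_forRange (N := n) (fun i τ => ∃ D, Serve ((sortedList n (σ.nat 10) k ++
        ((List.finRange n).take i).filter fun j : Fin n => σ.nat 10 j = k).filter c) R D ∧
        Records (M ∪ D) t o2 o3 (τ.nat 2) (τ.nat 3) (τ.nat 8)) hIρ.cell_n hn rfl rfl
        (by decide) ?_ ?_ ?_
    · simpa using hρ
    · intro i hi ρ' hρ' h18 hF'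
      have hIρ' := hIρ.frame hF' rfl rfl rfl
      obtain ⟨D, hD, hrec'⟩ := hρ'
      have e4 : ρ'.nat 4 = σ.nat 4 := (hF'.nat 4 rfl).trans (hF.nat 4 rfl)
      have e7 : ρ'.nat 7 = σ.nat 7 := (hF'.nat 7 rfl).trans (hF.nat 7 rfl)
      have e10 : ρ'.nat 10 = σ.nat 10 := (hF'.nat 10 rfl).trans (hF.nat 10 rfl)
      have e11 : ρ'.nat 11 = σ.nat 11 := (hF'.nat 11 rfl).trans (hF.nat 11 rfl)
      have e19 : ρ'.nat 19 0 = k := by rw [hF'.nat 19 rfl, h19]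
      simp only [wp_ite, Test.Holds, Test.holds_natEq, NatExp.eval, NatExp.eval_var,
        NatExp.eval_entry, e4, e7, e10, h18, e19, filter_take_succ hi]
      constructor
      · rintro ⟨h4, h7, h10⟩
        have hci := (hc ⟨i, hi⟩).2 ⟨h4, h7⟩
        have hw := wp_giveFree (i := ⟨i, hi⟩) hIρ' hm (by rw [e11, ht]) ht0 hR h18 (hcM _ hci)
          (l := (sortedList n (σ.nat 10) k ++
            ((List.finRange n).take i).filter fun j : Fin n => σ.nat 10 j = k).filter c) ?_ hD hrec'
        · refine hw.mono fun τ hτ => ?_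
          simpa [h10, hci] using hτ
        · simp only [List.mem_filter, List.mem_append, mem_sortedList, h10, lt_irrefl, false_or,
            not_and]
          intro hmem
          have := hmem.1
          rw [List.mem_take_iff_getElem] at this
          obtain ⟨j, hj, hji⟩ := this
          simp [Fin.ext_iff] at hji hj
          omega
      · intro hno
        rw [wp_skip]
        refine ⟨D, ?_, by simpa using hrec'⟩
        by_cases h10 : σ.nat 10 i = k
        · have hci : ¬ c ⟨i, hi⟩ = true := by
            rw [hc]
            exact fun h => hno ⟨h.1, h.2, h10⟩
          simpa [h10, hci] using hD
        · simpa [h10] using hD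
    · intro ρ' hρ' _ _
      rw [List.take_of_length_le (by simp), ← sortedList_succ] at hρ'
      simpa using hρ'

end Program

end MatchFreeze

/-! ### Freezing and the end of a round -/

namespace MatchFreeze

variable {n m : ℕ} {a b : ℝ} {v : Fin n → Fin m → ℝ}

namespace Program

open NatExp (var entry const)

variable {B : ℕ} {σ : Memory}

/-- The agent `i`, not in the set given by the row `r9`, has to freeze because of the agent `j`. -/
def MustFreeze (a b : ℝ) (v : Fin n → Fin m → ℝ) (E : Finset (Fin n × Fin m)) (r9 : ℕ → ℕ)
    (i j : Fin n) : Prop :=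
  r9 i = 0 ∧ ∃ g, (i, g) ∈ E ∧ v j g = a ∧ (0 < r9 j ∨ ∃ h, (j, h) ∈ E ∧ v j h = b)

/-- Row `8` holds the received good plus one, and zero if there is none; hence the subtraction in
the test. -/
theorem holds_mustFreeze {E : Finset (Fin n × Fin m)} {t : ℕ} {o2 o3 r2 r3 : ℕ → ℕ}
    (hv : IsTwoValue a b v) (hI : HasInput a b v σ) (hrec : Records E t o2 o3 r2 r3 (σ.nat 8))
    {x y : NatExp} {i j : Fin n} (hx : x.eval σ = i) (hy : y.eval σ = j) :
    (mustFreeze x y).Holds σ ↔ MustFreeze a b v E (σ.nat 9) i j := by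
  -- the value of a good that an agent has received
  have hlow : ∀ z : NatExp, ∀ k : Fin n, z.eval σ = k → ∀ g, (k, g) ∈ E →
      ((isLow y (.sub (entry 8 z) (const 1))).Holds σ ↔ v j g < a) := by
    intro z k hz g hg
    have hg' : (NatExp.sub (entry 8 z) (const 1)).eval σ = g := by
      rw [hrec.mem_iff] at hg
      simp [hz, hg]
    rw [holds_isLow hI (by rw [hy]; exact j.2) (by rw [hg']; exact g.2)]
    simp only [hy, hg']
  simp only [mustFreeze, Test.Holds, Test.holds_natEq, Test.holds_or, NatExp.eval,
    NatExp.eval_entry, hx, hy, hrec.ne_zero_iff, MustFreeze]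
  constructor
  · rintro ⟨⟨h1, g, hg⟩, h2, h3⟩
    rw [hlow x i hx g hg, hv.not_lt_iff] at h2
    refine ⟨h1, g, hg, h2, h3.imp_right ?_⟩
    rintro ⟨⟨h, hh⟩, h4⟩
    rw [hlow y j hy h hh, hv.lt_iff] at h4
    exact ⟨h, hh, h4⟩
  · rintro ⟨h1, g, hg, h2, h3⟩
    refine ⟨⟨h1, g, hg⟩, ?_, h3.imp_right ?_⟩
    · rw [hlow x i hx g hg, hv.not_lt_iff]
      exact h2
    · rintro ⟨h, hh, h4⟩
      refine ⟨⟨h, hh⟩, ?_⟩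
      rw [hlow y j hy h hh, hv.lt_iff]
      exact h4

theorem wp_findFreezing {E : Finset (Fin n × Fin m)} {t : ℕ} {o2 o3 r2 r3 : ℕ → ℕ}
    (hv : IsTwoValue a b v) (hI : HasInput a b v σ) (hn : n ≤ B)
    (hrec : Records E t o2 o3 r2 r3 (σ.nat 8)) :
    findFreezing.WP B (fun τ => IsFound n
      (fun i => ∃ hi : i < n, ∃ j, MustFreeze a b v E (σ.nat 9) ⟨i, hi⟩ j) (τ.nat 14 0)) σ := by
  set T : ℕ → Prop := fun i => ∃ hi : i < n, ∃ j, MustFreeze a b v E (σ.nat 9) ⟨i, hi⟩ j with hT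
  rw [findFreezing, wp_seq, wp_assign]
  refine wp_forRange (N := n) (fun k τ => (τ.nat 14 0 < k ∧ T (τ.nat 14 0)) ∨
    τ.nat 14 0 = n ∧ ∀ l < k, ¬ T l) ?_ hn rfl rfl (by decide) ?_ ?_ (fun _ h _ _ => h)
  · simpa using hI.cell_n
  · simp [hI.cell_n]
  intro k hk ρ hρ h18 hF
  have hIρ : HasInput a b v ρ :=
    hI.congr (by simpa using hF.nat 0 rfl) (by simpa using hF.nat 1 rfl)
      (by simpa using hF.real rfl)
  have e8 : ρ.nat 8 = σ.nat 8 := by simpa using hF.nat 8 rfl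
  have e9 : ρ.nat 9 = σ.nat 9 := by simpa using hF.nat 9 rfl
  refine wp_forRange (N := n) (fun l τ => (τ.nat 14 0 < k + 1 ∧ T (τ.nat 14 0)) ∨
    τ.nat 14 0 = n ∧ (∀ l < k, ¬ T l) ∧
      ∀ j : Fin n, j < l → ¬ MustFreeze a b v E (σ.nat 9) ⟨k, hk⟩ j)
    hIρ.cell_n hn rfl rfl (by decide) ?_ ?_ ?_
  · simp only [Memory.setNat_nat, Nat.reduceEqDiff, if_false]
    rcases hρ with h | h
    · exact Or.inl ⟨by omega, h.2⟩
    · exact Or.inr ⟨h.1, h.2, by simp⟩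
  · intro l hl ρ' hρ' h17 hF'
    have hIρ' := hIρ.frame hF' rfl rfl rfl
    have e18 : ρ'.nat 18 = ρ.nat 18 := hF'.nat 18 rfl
    have e8' : ρ'.nat 8 = σ.nat 8 := (hF'.nat 8 rfl).trans e8
    have e9' : ρ'.nat 9 = σ.nat 9 := (hF'.nat 9 rfl).trans e9
    have hmust := holds_mustFreeze hv hIρ' (e8' ▸ hrec) (x := var 18) (y := var 17)
      (i := ⟨k, hk⟩) (j := ⟨l, hl⟩) (by simp [e18, h18]) (by simp [h17])
    rw [e9'] at hmust
    simp only [wp_ite, wp_assign, wp_skip, hmust, NatExp.eval, NatExp.eval_var, e18, h18]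
    constructor
    · intro h
      left
      simp only [Memory.setNat_nat, Nat.reduceEqDiff, if_false, if_true,
        Function.update_self]
      exact ⟨by omega, hk, _, h⟩
    · intro h
      simp only [Memory.setNat_nat, Nat.reduceEqDiff, if_false]
      refine hρ'.imp_right fun h' => ⟨h'.1, h'.2.1, fun j hj => ?_⟩
      by_cases hjl : (j : ℕ) = l
      · have : j = ⟨l, hl⟩ := Fin.ext hjl
        rwa [this]
      · exact h'.2.2 j (by omega)
  · intro ρ' hρ' _ _
    simp only [Memory.setNat_nat, Nat.reduceEqDiff, if_false]
    refine hρ'.imp_right fun h' => ⟨h'.1, fun l hl => ?_⟩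
    rcases Nat.lt_succ_iff_lt_or_eq.1 hl with h1 | rfl
    · exact h'.2.1 l h1
    · rintro ⟨_, j, hj⟩
      exact h'.2.2 j j.2 hj

/-- Marked agents always belong to the smallest set. When the search fails, the marked set is closed
under both rules and therefore is the smallest set. Each run marks a new agent, which bounds the
loop. -/
theorem wp_freeze {E : Finset (Fin n × Fin m)} {t : ℕ} {o2 o3 r2 r3 : ℕ → ℕ}
    (hv : IsTwoValue a b v) (hI : HasInput a b v σ) (hn : n ≤ B)
    (hrec : Records E t o2 o3 r2 r3 (σ.nat 8)) (h9 : ∀ i < n, σ.nat 9 i = 0) :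
    freeze.WP B (fun τ => ∀ i : Fin n, 0 < τ.nat 9 i ↔ Freezes a b v E i) σ := by
  rw [freeze, wp_seq]
  refine (wp_findFreezing hv hI hn hrec).mono_frame fun ρ hρ hF => ?_
  have hIρ := hI.frame hF rfl rfl rfl
  have e8 : ρ.nat 8 = σ.nat 8 := hF.nat 8 rfl
  have e9 : ρ.nat 9 = σ.nat 9 := hF.nat 9 rfl
  refine wp_loop (fun τ => (∀ i : Fin n, 0 < τ.nat 9 i → Freezes a b v E i) ∧ IsFound n
      (fun i => ∃ hi : i < n, ∃ j, MustFreeze a b v E (τ.nat 9) ⟨i, hi⟩ j) (τ.nat 14 0))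
    (fun τ => ((Finset.range n).filter fun i => τ.nat 9 i = 0).card) ?_ ?_ ?_ ?_
  · refine ⟨fun i hi => ?_, by rwa [e9]⟩
    rw [e9, h9 i i.2] at hi
    omega
  · exact (Finset.card_filter_le _ _).trans (by simpa using hn)
  · rintro τ ⟨hsound, hf⟩ hF' ht
    have hIτ := hIρ.frame hF' rfl rfl rfl
    simp only [Test.Holds, NatExp.eval_var, hIτ.cell_n] at ht
    obtain ⟨_, j, hj0, g, hg, hva, hor⟩ := (hf.resolve_right fun h => by omega).2
    set i : Fin n := ⟨τ.nat 14 0, ht⟩ with hi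
    have hfi : Freezes a b v E i := by
      rcases hor with h | ⟨h, hh, hb⟩
      · exact .step i j g (hsound j h) hg hva
      · exact .base i j g h hg hh hva hb
    have e8' : τ.nat 8 = σ.nat 8 := (hF'.nat 8 rfl).trans e8
    rw [wp_seq, wp_assign]
    refine (wp_findFreezing hv (hIτ.congr (by simp) (by simp) (by simp)) hn
      (by simpa [e8'] using hrec)).mono_frame fun τ' hτ' hF'' => ?_
    have e9' : τ'.nat 9 = Function.update (τ.nat 9) (τ.nat 14 0) 1 := by
      simpa using hF''.nat 9 rfl
    rw [e9']
    refine ⟨⟨fun k hk => ?_, by simpa using hτ'⟩, Finset.card_lt_card ?_⟩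
    · by_cases hki : (k : ℕ) = τ.nat 14 0
      · have : k = i := Fin.ext hki
        rwa [this]
      · rw [Function.update_of_ne hki] at hk
        exact hsound k hk
    · rw [Finset.ssubset_iff_of_subset]
      · exact ⟨τ.nat 14 0, by simpa using ⟨ht, hj0⟩, by simp⟩
      · intro k
        by_cases hki : k = τ.nat 14 0
        · subst hki
          simp
        · simp [Function.update_of_ne hki]
  · rintro τ ⟨hsound, hf⟩ hF' ht i
    have hIτ := hIρ.frame hF' rfl rfl rfl
    simp only [Test.Holds, NatExp.eval_var, hIτ.cell_n] at ht
    have hno := (hf.resolve_left fun h => ht h.1).2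
    have key : ∀ i j g, (i, g) ∈ E → v j g = a →
        (0 < τ.nat 9 j ∨ ∃ h, (j, h) ∈ E ∧ v j h = b) → 0 < τ.nat 9 i := by
      intro i j g hg hva hor
      by_contra hc
      exact hno i i.2 ⟨i.2, j, Nat.eq_zero_of_not_pos hc, g, hg, hva, hor⟩
    refine ⟨hsound i, fun hi => ?_⟩
    induction hi with
    | base i j g h hi hj hg hh => exact key i j g hi hg (Or.inr ⟨h, hj, hh⟩)
    | step i j g hj hi hg ih => exact key i j g hi hg (Or.inl ih)

theorem wp_finishRound (hI : HasInput a b v σ) (hn : n ≤ B) :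
    finishRound.WP B (fun τ => ∀ i < n,
      τ.nat 4 i = (if 0 < σ.nat 9 i then σ.nat 12 0 else σ.nat 4 i - 1) ∧
      τ.nat 10 i = if 0 < σ.nat 9 i then σ.nat 11 0 else σ.nat 10 i) σ := by
  refine wp_forRange (N := n) (fun k τ =>
    (∀ i < k, τ.nat 4 i = (if 0 < σ.nat 9 i then σ.nat 12 0 else σ.nat 4 i - 1) ∧
      τ.nat 10 i = if 0 < σ.nat 9 i then σ.nat 11 0 else σ.nat 10 i) ∧
    -- The rows are overwritten in place, so the entries not yet visited must be known to be old.
    ∀ i, k ≤ i → τ.nat 4 i = σ.nat 4 i ∧ τ.nat 10 i = σ.nat 10 i) hI.cell_n hn rfl rfl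
    (by decide) (by simp) ?_ (fun _ h _ _ => h.1)
  rintro k hk ρ ⟨hρ1, hρ2⟩ h18 hF
  have e9 : ρ.nat 9 = σ.nat 9 := hF.nat 9 rfl
  have e11 : ρ.nat 11 = σ.nat 11 := hF.nat 11 rfl
  have e12 : ρ.nat 12 = σ.nat 12 := hF.nat 12 rfl
  have hk' := hρ2 k le_rfl
  simp only [wp_ite, wp_seq, wp_assign, Test.Holds, NatExp.eval, NatExp.eval_var,
    NatExp.eval_entry, e9, e12, h18]
  constructor <;> intro hpos <;> refine ⟨fun i hi => ?_, fun i hi => ?_⟩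
  · by_cases hik : i = k
    · subst hik
      simp [h18, hpos, e11]
    · have := hρ1 i (by omega)
      simpa [h18, hik] using this
  · have := hρ2 i (by omega)
    have hik : i ≠ k := by omega
    simpa [h18, hik] using this
  · by_cases hik : i = k
    · subst hik
      simp [hpos, hk']
    · have := hρ1 i (by omega)
      simpa [hik] using this
  · have := hρ2 i (by omega)
    have hik : i ≠ k := by omega
    simpa [hik] using this

end Program

end MatchFreeze

/-! ### Simulation of an execution by the program -/

namespace MatchFreeze

variable {n m : ℕ} {a b : ℝ} {v : Fin n → Fin m → ℝ}

open scoped Classical in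
/-- The state after a round with the matching `M`, the pairs `D` handed out afterwards, and the
new list `l`. -/
noncomputable def State.next (a b : ℝ) (v : Fin n → Fin m → ℝ) (s : State n m)
    (M D : Finset (Fin n × Fin m)) (l : List (Fin n)) : State n m where
  bundle i := s.bundle i ∪ Finset.univ.filter fun g => (i, g) ∈ M ∪ D
  rest := s.rest \ (M ∪ D).image Prod.snd
  wait i := if Freezes a b v (M ∪ D) i then freezeLength a b else s.wait i - 1
  order := l

open scoped Classical in
/-- The list after a round when the keys of the agents that freeze are set to `t`. -/
theorem sortedList_update {key key' : ℕ → ℕ} {t : ℕ} {F : Fin n → Prop}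
    (hkey : ∀ i : Fin n, key i < t) (hkey' : ∀ i : Fin n, key' i = if F i then t else key i) :
    sortedList n key' (t + 1) =
      (sortedList n key t).filter (fun i => ¬ F i) ++ (List.finRange n).filter fun i => F i := by
  rw [sortedList_succ]
  congr 1
  · unfold sortedList
    rw [List.filter_flatMap]
    refine List.flatMap_congr fun k hk => ?_
    rw [List.filter_filter]
    refine List.filter_congr fun i _ => ?_
    rw [List.mem_range] at hk
    rw [hkey']
    by_cases hF : F i
    · simp [hF]; omega
    · simp [hF]
  · refine List.filter_congr fun i _ => ?_
    have := hkey i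
    rw [hkey']
    by_cases hF : F i
    · simp [hF]
    · simp [hF]; omega

/-- The memory `σ` represents the state after the first `t` rounds of the execution `S`. -/
structure Simulates (a b : ℝ) (v : Fin n → Fin m → ℝ) (S : ℕ → State n m) (t : ℕ)
    (σ : Memory) : Prop where
  input : HasInput a b v σ
  exec : IsExecution a b v S t
  time : σ.nat 11 0 = t
  length : (σ.nat 12 0 : ℕ∞) = min (m : ℕ∞) (freezeLength a b)
  rest : ∀ g : Fin m, g ∈ (S t).rest ↔ σ.nat 3 g = 0
  wait : ∀ i : Fin n, (S t).wait i = σ.nat 4 i ∨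
    m ≤ σ.nat 4 i + t ∧ (m : ℕ∞) ≤ (S t).wait i + t
  key : ∀ i : Fin n, σ.nat 10 i ≤ t
  order : (S t).order = sortedList n (σ.nat 10) (t + 1)
  output : ∀ g : Fin m, g ∉ (S t).rest → ∃ i : Fin n, ∃ u < t, σ.nat 2 g = i ∧ σ.nat 3 g = u + 1 ∧
    g ∉ (S u).bundle i ∧ g ∈ (S (u + 1)).bundle i

theorem IsExecution.update {S : ℕ → State n m} {t : ℕ} {s : State n m}
    (h : IsExecution a b v S t) (hne : (S t).rest ≠ ∅) (hs : Round a b v (S t) s) :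
    IsExecution a b v (Function.update S (t + 1) s) (t + 1) := by
  refine ⟨by simpa using h.1, fun u hu => ?_⟩
  rw [Function.update_of_ne (by omega : u ≠ t + 1)]
  rcases Nat.lt_succ_iff_lt_or_eq.1 hu with h1 | rfl
  · rw [Function.update_of_ne (by omega)]
    exact h.2 u h1
  · rw [Function.update_self]
    exact ⟨hne, hs⟩

/-- The machine caps freeze lengths at `m`. A counter that differs from the true waiting time, like
that time itself, reaches at least to round `m`; this persists, since each drops by at most one as
`t` grows by one. -/
theorem wait_next {W w w' : ℕ∞} {c c' : ℕ} {t : ℕ} {F : Prop} [Decidable F] {k : ℕ}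
    (hk : (k : ℕ∞) = min (m : ℕ∞) W) (htm : t < m)
    (hw : w = c ∨ m ≤ c + t ∧ (m : ℕ∞) ≤ w + t)
    (hw' : w' = if F then W else w - 1) (hc' : c' = if F then k else c - 1) :
    w' = c' ∨ m ≤ c' + (t + 1) ∧ (m : ℕ∞) ≤ w' + (t + 1 : ℕ) := by
  subst hw' hc'
  split_ifs
  · rcases le_total (m : ℕ∞) W with h | h
    · rw [min_eq_left h] at hk
      have hk' : k = m := by exact_mod_cast hk
      exact Or.inr ⟨by omega, h.trans le_self_add⟩
    · rw [min_eq_right h] at hk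
      exact Or.inl hk.symm
  · rcases hw with rfl | ⟨h1, h2⟩
    · left
      norm_cast
    · right
      refine ⟨by omega, ?_⟩
      induction w with
      | top => simp
      | coe w =>
        norm_cast at h2 ⊢
        omega

namespace Program

variable {B : ℕ} {σ : Memory}

-- The matching is read off from the auction and the further pairs from the serving phase; the frame
-- rule transports the other rows through the phases `σ₁` to `σ₅`.
open scoped Classical in
theorem wp_round {S : ℕ → State n m} {t : ℕ} (hn0 : 0 < n) (hv : IsTwoValue a b v)
    (hn : n ≤ B) (hm : m ≤ B) (hB : m * (m + 1) + n ≤ B) (h : Simulates a b v S t σ)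
    (hne : (S t).rest ≠ ∅) :
    round.WP B (fun τ => ∃ S', Simulates a b v S' (t + 1) τ) σ := by
  have hwf := h.exec.wellFormed hn0 hv t le_rfl
  have htm : t < m := by
    have h1 := h.exec.card_rest_add_le hn0 hv t le_rfl
    have h2 := Finset.card_pos.2 (Finset.nonempty_iff_ne_empty.2 hne)
    omega
  have hL : ∀ i : Fin n, i ∈ (S t).active ↔ σ.nat 4 i = 0 := by
    intro i
    simp only [State.active, Finset.mem_filter, Finset.mem_univ, true_and]
    -- In the capped case both the counter and the true waiting time are positive, because `t < m`.
    rcases h.wait i with h1 | ⟨h1, h2⟩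
    · rw [h1]
      norm_cast
    · constructor
      · intro h0
        rw [h0, zero_add] at h2
        norm_cast at h2
        omega
      · omega
  rw [round, wp_seq, wp_assign]
  set σ₀ := σ.setNat 11 ((NatExp.const 0).eval σ)
    ((NatExp.add (.var 11) (.const 1)).eval σ) with hσ₀
  have q : ∀ r, r ≠ 11 → σ₀.nat r = σ.nat r := fun r hr => by simp [hσ₀, hr]
  have q11 : σ₀.nat 11 0 = t + 1 := by simp [hσ₀, h.time]
  have hI₀ : HasInput a b v σ₀ := h.input.congr (q 0 (by decide)) (q 1 (by decide)) rfl
  rw [wp_seq]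
  refine (wp_initRound hI₀ hn hm).mono_frame fun σ₁ ⟨ha1, ha2⟩ hF₁ => ?_
  have hI₁ := hI₀.frame hF₁ rfl rfl rfl
  have p3 : σ₁.nat 3 = σ.nat 3 := (hF₁.nat 3 rfl).trans (q 3 (by decide))
  have p4 : σ₁.nat 4 = σ.nat 4 := (hF₁.nat 4 rfl).trans (q 4 (by decide))
  have p4' : σ₀.nat 4 = σ.nat 4 := q 4 (by decide)
  have hL₁ : ∀ i : Fin n, i ∈ (S t).active ↔ σ₁.nat 4 i = 0 := by rwa [p4]
  have hR₁ : ∀ g : Fin m, g ∈ (S t).rest ↔ σ₁.nat 3 g = 0 := by rw [p3]; exact h.rest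
  have hA₁ : Auction n m (natAdj a v (S t).active (S t).rest) (σ₁.nat 5) (σ₁.nat 6)
      (σ₁.nat 7) := by
    refine Auction.initial (fun i g h => ⟨h.1, h.2.1⟩) (fun g hg => (ha2 g hg).1)
      (fun g hg => (ha2 g hg).2) (fun i hi => ?_) ?_
    · rw [(ha1 i hi).1]
      split_ifs <;> simp
    · rintro i g ⟨hi, hg, hadj, -⟩
      rw [hL] at hadj
      rw [(ha1 i hi).1, p4', if_pos hadj]
  rw [wp_seq]
  refine (wp_auction hv hI₁ hL₁ hR₁ hn hm hB hA₁).mono_frame fun σ₂ ⟨hA₂, hend⟩ hF₂ => ?_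
  have hI₂ := hI₁.frame hF₂ rfl rfl rfl
  set M := heldPairs n m (σ₂.nat 5) with hM
  have hmax : IsMaximumMatching a v (S t).active (S t).rest M := hA₂.isMaximumMatching hend
  have q11₂ : σ₂.nat 11 0 = t + 1 := by rw [hF₂.nat 11 rfl, hF₁.nat 11 rfl, q11]
  have p3₂ : σ₂.nat 3 = σ.nat 3 := (hF₂.nat 3 rfl).trans p3
  have p2₂ : σ₂.nat 2 = σ.nat 2 := by rw [hF₂.nat 2 rfl, hF₁.nat 2 rfl, q 2 (by decide)]
  rw [wp_seq]
  refine (wp_giveMatched (t := t + 1) hI₂ hm q11₂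
    (fun i hi => by rw [hF₂.nat 8 rfl]; exact (ha1 i hi).2.1) hA₂).mono_frame
    fun σ₃ hrec₃ hF₃ => ?_
  have hI₃ := hI₂.frame hF₃ rfl rfl rfl
  rw [p2₂, p3₂, ← hM] at hrec₃
  have q11₃ : σ₃.nat 11 0 = t + 1 := by rw [hF₃.nat 11 rfl, q11₂]
  have p4₃ : σ₃.nat 4 = σ.nat 4 := by rw [hF₃.nat 4 rfl, hF₂.nat 4 rfl, p4]
  have p7₃ : σ₃.nat 7 = σ₂.nat 7 := hF₃.nat 7 rfl
  have p10₃ : σ₃.nat 10 = σ.nat 10 := by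
    rw [hF₃.nat 10 rfl, hF₂.nat 10 rfl, hF₁.nat 10 rfl, q 10 (by decide)]
  have hst : ∀ i : Fin n, σ₂.nat 7 i = 2 ↔ ∀ g, (i, g) ∉ M := by
    intro i
    simp only [hM, mem_heldPairs]
    constructor
    · intro h2 g hg
      have := hA₂.st_of_own i g g.2 hg
      omega
    · intro hno
      have h0 := hend i i.2
      have h2 := hA₂.st_le i i.2
      have h1 : σ₂.nat 7 i ≠ 1 := by
        intro h1
        obtain ⟨g, hg, ho⟩ := hA₂.own_of_st i i.2 h1
        exact hno ⟨g, hg⟩ ho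
      omega
  rw [wp_seq]
  refine (wp_serve (t := t + 1) (o2 := σ.nat 2) (o3 := σ.nat 3) (M := M)
    (R := (S t).rest \ M.image Prod.snd)
    (c := fun i => decide (i ∈ (S t).active ∧ i ∉ M.image Prod.fst)) hI₃ hn hm (by omega) q11₃
    (by omega) ?_ ?_ ?_ hrec₃).mono_frame fun σ₄ ⟨D, hD, hrec₄⟩ hF₄ => ?_
  · intro g
    rw [← h.rest]
    simp
  · intro i
    rw [p4₃, p7₃, hst, ← hL]
    simp
  · intro i hi
    simp at hi
    exact hi.2
  rw [p10₃, ← h.order] at hD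
  have hI₄ := hI₃.frame hF₄ rfl rfl rfl
  rw [wp_seq]
  refine (wp_freeze hv hI₄ hn hrec₄ fun i hi => ?_).mono_frame fun σ₅ hfr hF₅ => ?_
  · rw [hF₄.nat 9 rfl, hF₃.nat 9 rfl, hF₂.nat 9 rfl]
    exact (ha1 i hi).2.2
  have hI₅ := hI₄.frame hF₅ rfl rfl rfl
  refine (wp_finishRound hI₅ hn).mono_frame fun τ hτ hF₆ => ?_
  have p11₅ : σ₅.nat 11 0 = t + 1 := by rw [hF₅.nat 11 rfl, hF₄.nat 11 rfl, q11₃]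
  have p4₅ : σ₅.nat 4 = σ.nat 4 := by rw [hF₅.nat 4 rfl, hF₄.nat 4 rfl, p4₃]
  have p10₅ : σ₅.nat 10 = σ.nat 10 := by rw [hF₅.nat 10 rfl, hF₄.nat 10 rfl, p10₃]
  have p12₅ : σ₅.nat 12 = σ.nat 12 := by
    rw [hF₅.nat 12 rfl, hF₄.nat 12 rfl, hF₃.nat 12 rfl, hF₂.nat 12 rfl, hF₁.nat 12 rfl,
      q 12 (by decide)]
  have p2τ : τ.nat 2 = σ₄.nat 2 := by rw [hF₆.nat 2 rfl, hF₅.nat 2 rfl]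
  have p3τ : τ.nat 3 = σ₄.nat 3 := by rw [hF₆.nat 3 rfl, hF₅.nat 3 rfl]
  have hkey' : ∀ i : Fin n, τ.nat 10 i =
      if Freezes a b v (M ∪ D) i then t + 1 else σ.nat 10 i := by
    intro i
    rw [(hτ i i.2).2, p11₅, p10₅]
    simp only [hfr]
  set l := sortedList n (τ.nat 10) (t + 1 + 1) with hl
  set s' := (S t).next a b v M D l with hs'
  -- Freezing agents get the largest key `t + 1`, so sorting moves them to the end in natural order,
  -- one of the admissible orders.
  have hround : Round a b v (S t) s' := by
    refine ⟨M, D, hmax, ?_, fun i => rfl, rfl, fun i => rfl,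
      (List.finRange n).filter fun i => Freezes a b v (M ∪ D) i, ?_, ?_⟩
    · convert hD
    · exact (hwf.order.symm).filter _
    · change l = _
      rw [hl, sortedList_update (fun i => Nat.lt_succ_of_le (h.key i)) hkey', ← h.order]
  have hold : ∀ u ≤ t, Function.update S (t + 1) s' u = S u := fun u hu =>
    Function.update_of_ne (by omega) _ _
  have hnew : Function.update S (t + 1) s' (t + 1) = s' := Function.update_self _ _ _
  refine ⟨Function.update S (t + 1) s', hI₅.frame hF₆ rfl rfl rfl, h.exec.update hne hround, ?_,
    ?_, ?_, ?_, ?_, ?_, ?_⟩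
  · rw [hF₆.nat 11 rfl, p11₅]
  · rw [hF₆.nat 12 rfl, p12₅, h.length]
  · intro g
    rw [hnew, p3τ, hrec₄.free_iff (by omega), ← h.rest]
    simp [hs', State.next]
  · intro i
    rw [hnew]
    refine wait_next (F := Freezes a b v (M ∪ D) i) h.length htm (h.wait i) rfl ?_
    rw [(hτ i i.2).1, p12₅, p4₅]
    simp only [hfr]
  · intro i
    rw [hkey']
    have := h.key i
    split_ifs <;> omega
  · rw [hnew]
    rfl
  · intro g hg
    rw [hnew] at hg
    have hg' : g ∉ (S t).rest ∨ ∃ i, (i, g) ∈ M ∪ D := by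
      by_contra! hc
      simp [hs', State.next, hc.1] at hg
      obtain ⟨i, hi⟩ := hg
      exact hc.2 i (Finset.mem_union.2 (or_iff_not_imp_left.2 hi))
    by_cases hE : ∃ i, (i, g) ∈ M ∪ D
    · obtain ⟨i, hi⟩ := hE
      have hmem : g ∈ (S t).rest := by
        rcases Finset.mem_union.1 hi with h1 | h1
        · exact (hmax.1.1 _ h1).2.1
        · exact (Finset.mem_sdiff.1 (hD.mem i g h1).2).1
      refine ⟨i, t, by omega, ?_, ?_, ?_, ?_⟩
      · rw [p2τ, (hrec₄.new i g hi).1]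
      · rw [p3τ, (hrec₄.new i g hi).2]
      · rw [hold t le_rfl]
        exact fun hc => Finset.disjoint_left.1 (hwf.disjoint_rest i) hc hmem
      · rw [hnew]
        simp only [hs', State.next, Finset.mem_union, Finset.mem_filter, Finset.mem_univ, true_and]
        right
        simpa using hi
    · obtain ⟨i, u, hu, h2, h3, h4, h5⟩ := h.output g (hg'.resolve_right hE)
      push Not at hE
      refine ⟨i, u, by omega, ?_, ?_, ?_, ?_⟩
      · rw [p2τ, (hrec₄.old g hE).1, h2]
      · rw [p3τ, (hrec₄.old g hE).2, h3]
      · rwa [hold u (by omega)]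
      · rwa [hold (u + 1) (by omega)]

/-- For `b > 0`, `⌊a / b - 1⌋` is the largest `k` with `(k + 1) * b ≤ a`. The real cell `(0, 2)`
holds `(k + 2) * b`, so deciding whether `k` can grow is a comparison with `a`. The stop at `m` also
ends the loop for `b = 0`. -/
theorem wp_computeFreezeLength (hv : IsTwoValue a b v) (hI : HasInput a b v σ) (hm : m ≤ B)
    (h12 : σ.nat 12 0 = 0) : computeFreezeLength.WP B (fun τ => HasInput a b v τ ∧
      (τ.nat 12 0 : ℕ∞) = min (m : ℕ∞) (freezeLength a b)) σ := by
  have hb := hv.nonneg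
  have hab := hv.lt
  have hset : ∀ ρ r, HasInput a b v ρ → HasInput a b v (ρ.setReal 0 2 r) := by
    intro ρ r hρ
    exact ⟨hρ.cell_n, hρ.cell_m, by simp [Memory.setReal_real, hρ.cell_a],
      by simp [Memory.setReal_real, hρ.cell_b], by simp [Memory.setReal_real, hρ.cell_v]⟩
  rw [computeFreezeLength, wp_seq, wp_setReal]
  refine wp_loop (fun ρ => HasInput a b v ρ ∧ ρ.nat 12 0 ≤ m ∧
      ρ.real 0 2 = (ρ.nat 12 0 + 2) * b ∧ (ρ.nat 12 0 + 1) * b ≤ a)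
    (fun ρ => m - ρ.nat 12 0) ⟨hset _ _ hI, ?_⟩ ?_ ?_ ?_
  · simp only [NatExp.eval, RealExp.eval, Memory.setReal_real, Memory.setReal_nat, h12,
      hI.cell_b, and_self, if_true]
    refine ⟨by omega, ?_, ?_⟩ <;> push_cast <;> linarith
  · simp only [Memory.setReal_nat]
    omega
  · rintro ρ ⟨hIρ, h1, h2, h3⟩ - ht
    simp only [Test.Holds, NatExp.eval_var, RealExp.eval, NatExp.eval, hIρ.cell_a, hIρ.cell_m, h2,
      not_lt] at ht
    rw [wp_seq, wp_setReal, wp_assign]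
    simp only [NatExp.eval, NatExp.eval_var, RealExp.eval, Memory.setReal_nat, Memory.setNat_nat,
      if_true, Function.update_self, Memory.setNat_real, Memory.setReal_real, hIρ.cell_b, h2,
      and_self]
    refine ⟨⟨(hset _ _ hIρ).congr (by simp) (by simp) rfl, by omega, ?_, ?_⟩, by omega⟩
    · push_cast
      ring
    · push_cast
      linarith
  · rintro ρ ⟨hIρ, h1, h2, h3⟩ - ht
    refine ⟨hIρ, ?_⟩
    simp only [Test.Holds, NatExp.eval_var, RealExp.eval, NatExp.eval, hIρ.cell_a, hIρ.cell_m, h2,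
      not_and, not_lt] at ht
    unfold freezeLength
    by_cases h0 : b = 0
    · rw [if_pos h0, min_top_right]
      have := ht (by rw [h0, mul_zero]; linarith)
      have : ρ.nat 12 0 = m := by omega
      rw [this]
    · have hb' : 0 < b := lt_of_le_of_ne hb (Ne.symm h0)
      have hle : ρ.nat 12 0 ≤ ⌊a / b - 1⌋₊ := by
        refine Nat.le_floor ?_
        rw [le_sub_iff_add_le, le_div_iff₀ hb']
        exact h3
      rw [if_neg h0]
      by_cases hm' : m ≤ ρ.nat 12 0
      · have : ρ.nat 12 0 = m := by omega
        rw [this] at hle ⊢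
        rw [min_eq_left (by exact_mod_cast hle)]
      · have hlt : a < (ρ.nat 12 0 + 2) * b := by
          by_contra hc
          exact hm' (ht (not_lt.1 hc))
        have hfl : ⌊a / b - 1⌋₊ < ρ.nat 12 0 + 1 := by
          rw [Nat.floor_lt' (by omega), sub_lt_iff_lt_add, div_lt_iff₀ hb']
          push_cast
          linarith
        have heq : ⌊a / b - 1⌋₊ = ρ.nat 12 0 := by omega
        rw [heq, min_eq_right (by exact_mod_cast h1)]

theorem wp_matchFreeze (hn0 : 0 < n) (hv : IsTwoValue a b v) (hn : n ≤ B) (hm : m ≤ B)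
    (hB : m * (m + 1) + n ≤ B) :
    matchFreeze.WP B (fun τ => ∃ (S : ℕ → State n m) (K : ℕ), IsExecution a b v S K ∧
      (S K).rest = ∅ ∧ HoldsOutput S K τ) (inputMemory a b v) := by
  have hrow : ∀ r, 2 ≤ r → (inputMemory a b v).nat r = fun _ => 0 := by
    intro r hr
    funext y
    obtain ⟨r, rfl⟩ := Nat.exists_eq_add_of_le' hr
    rfl
  have hI : HasInput a b v (inputMemory a b v) :=
    ⟨rfl, rfl, rfl, rfl, fun i g => by simp [inputMemory]⟩
  rw [matchFreeze, wp_seq]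
  refine (wp_computeFreezeLength hv hI hm (by rw [hrow 12 (by omega)])).mono_frame
    fun σ ⟨hIσ, h12⟩ hF => ?_
  have hrow' : ∀ r, 2 ≤ r → computeFreezeLength.keeps r = true → σ.nat r = fun _ => 0 :=
    fun r hr hk => (hF.nat r hk).trans (hrow r hr)
  have h2 := hrow' 2 (by omega) rfl
  have h3 := hrow' 3 (by omega) rfl
  have h4 := hrow' 4 (by omega) rfl
  have h10 := hrow' 10 (by omega) rfl
  have h11 := hrow' 11 (by omega) rfl
  rw [wp_seq]
  refine (wp_findFree hIσ hm).mono_frame fun ρ hρ hF' => ?_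
  refine wp_loop (fun τ => (∃ S, Simulates a b v S (τ.nat 11 0) τ) ∧
      IsFound m (fun g => τ.nat 3 g = 0) (τ.nat 13 0)) (fun τ => m - τ.nat 11 0) ?_ ?_ ?_ ?_
  · have e3 := hF'.nat 3 rfl
    have e11 := hF'.nat 11 rfl
    refine ⟨⟨fun _ => start n m, hIσ.frame hF' rfl rfl rfl, ⟨rfl, fun t ht => ?_⟩, rfl, ?_, ?_, ?_,
      ?_, ?_, ?_⟩, by rwa [e3]⟩
    · simp [e11, h11] at ht
    · rw [hF'.nat 12 rfl, h12]
    · intro g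
      simp [start, e3, h3]
    · intro i
      left
      simp [start, hF'.nat 4 rfl, h4]
    · intro i
      simp [hF'.nat 10 rfl, h10]
    · simp [start, hF'.nat 10 rfl, h10, e11, h11, sortedList]
    · intro g hg
      simp [start] at hg
  · omega
  · rintro τ ⟨⟨S, hS⟩, hf⟩ - ht
    simp only [Test.Holds, NatExp.eval_var, hS.input.cell_m] at ht
    have hmem := (hf.resolve_right fun h => by omega).2
    have hne : (S (τ.nat 11 0)).rest ≠ ∅ := by
      intro hc
      have := (hS.rest ⟨τ.nat 13 0, ht⟩).2 hmem
      simp [hc] at this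
    have htm : τ.nat 11 0 < m := by
      have h1 := hS.exec.card_rest_add_le hn0 hv _ le_rfl
      have h2 := Finset.card_pos.2 (Finset.nonempty_iff_ne_empty.2 hne)
      omega
    rw [wp_seq]
    refine (wp_round hn0 hv hn hm hB hS hne).mono fun τ' ⟨S', hS'⟩ => ?_
    refine (wp_findFree hS'.input hm).mono_frame fun τ'' hf' hF'' => ?_
    have e3 : τ''.nat 3 = τ'.nat 3 := hF''.nat 3 rfl
    have e11 : τ''.nat 11 0 = τ.nat 11 0 + 1 := by rw [hF''.nat 11 rfl, hS'.time]
    refine ⟨⟨⟨S', ?_⟩, by rwa [e3]⟩, by omega⟩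
    rw [e11]
    refine ⟨hS'.input.frame hF'' rfl rfl rfl, hS'.exec, e11, ?_, ?_, ?_, ?_, ?_, ?_⟩
    · rw [hF''.nat 12 rfl]; exact hS'.length
    · rw [e3]; exact hS'.rest
    · rw [hF''.nat 4 rfl]; exact hS'.wait
    · rw [hF''.nat 10 rfl]; exact hS'.key
    · rw [hF''.nat 10 rfl]; exact hS'.order
    · rw [hF''.nat 2 rfl, e3]; exact hS'.output
  · rintro τ ⟨⟨S, hS⟩, hf⟩ - ht
    simp only [Test.Holds, NatExp.eval_var, hS.input.cell_m] at ht
    have hno := (hf.resolve_left fun h => ht h.1).2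
    have hrest : (S (τ.nat 11 0)).rest = ∅ := by
      rw [Finset.eq_empty_iff_forall_notMem]
      intro g hg
      exact hno g g.2 ((hS.rest g).1 hg)
    exact ⟨S, _, hS.exec, hrest, fun g => hS.output g (by simp [hrest])⟩

end Program

end MatchFreeze

theorem theorem5 :
    (∀ (n m : ℕ) (a b : ℝ) (v : Fin n → Fin m → ℝ), 0 < n → MatchFreeze.IsTwoValue a b v →
      ∀ (S : ℕ → MatchFreeze.State n m) (K : ℕ), MatchFreeze.IsExecution a b v S K →
        K ≤ m ∧
        ((S K).rest ≠ ∅ → ∃ s, MatchFreeze.Round a b v (S K) s) ∧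
        ((S K).rest = ∅ →
          MatchFreeze.IsAllocation (S K).bundle ∧ MatchFreeze.IsEFX0 v (S K).bundle)) ∧
    (∃ (P : MatchFreeze.Program) (p : Polynomial ℕ),
      ∀ (n m : ℕ) (a b : ℝ) (v : Fin n → Fin m → ℝ), 0 < n → MatchFreeze.IsTwoValue a b v →
        ∃ (k : ℕ) (τ : MatchFreeze.Memory) (S : ℕ → MatchFreeze.State n m) (K : ℕ),
          MatchFreeze.Exec P (MatchFreeze.inputMemory a b v) k τ ∧
          k ≤ p.eval (n + m) ∧
          MatchFreeze.IsExecution a b v S K ∧ (S K).rest = ∅ ∧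
          MatchFreeze.HoldsOutput S K τ) := by
  refine ⟨fun n m a b v hn hv S K h => ⟨?_, fun _ => MatchFreeze.exists_round _, fun hrest =>
    ⟨h.isAllocation hn hv hrest, h.isEFX0 hn hv⟩⟩, MatchFreeze.Program.matchFreeze,
    MatchFreeze.Program.matchFreeze.bound.comp ((.X + 1) ^ 2), fun n m a b v hn hv => ?_⟩
  · have := h.card_rest_add_le hn hv K le_rfl
    omega
  -- The number `(n + m + 1) ^ 2` dominates `n`, `m` and the bound `m * (m + 1) + n` for the
  -- auction, hence every loop count.
  · obtain ⟨k, τ, hexec, hk, S, K, h1, h2, h3⟩ :=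
      (MatchFreeze.Program.wp_matchFreeze (B := (n + m + 1) ^ 2) hn hv
        ((by omega : n ≤ n + m + 1).trans (Nat.le_self_pow two_ne_zero _))
        ((by omega : m ≤ n + m + 1).trans (Nat.le_self_pow two_ne_zero _)) (by nlinarith)).exec
    refine ⟨k, τ, S, K, hexec, ?_, h1, h2, h3⟩
    simpa using hk
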